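/- **Setting.** Seifert invariants $\sigma=(o\text{ or }n,\,g,\,p,\,b\mid(\alpha_1,\beta_1),\dots,(\alpha_q,\beta_q))$ consist of integers $g,p\ge 0$, $b\in\mathbb Z$ and coprime pairs with $0<\beta_j<\alpha_j$, the letter $o$ or $n$ telling whether the base is orientable, with $g\ge 1$ in case $n$. Let $\pi(\sigma)$ be the group with the canonical presentation: in case $o$, generators $a_i,b_i,c_j,d_k,h$ and relations $$[a_i,h]=[b_i,h]=[c_j,h]=[d_k,h]=1,\quad c_j^{\alpha_j}=h^{\beta_j},\quad h^b=\Big(\prod_{i=1}^g[a_i,b_i]\Big)c_1\cdots c_q\,d_1\cdots d_p;$$ in case $n$, generators $a_i,c_j,d_k,h$ and relations $$a_iha_i^{-1}=h^{-1},\quad [c_j,h]=[d_k,h]=1,\quad c_j^{\alpha_j}=h^{\beta_j},\quad h^b=\Big(\prod_{i=1}^g a_i^2\Big)c_1\cdots c_q\,d_1\cdots d_p$$ ($1\le i\le g$, $1\le j\le q$, $1\le k\le p$). A Seifert fibered space is a compact connected 3-manifold $M$ partitioned into circles (fibers), each with a closed saturated neighborhood that is fiber-preservingly homeomorphic to a fibered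 solid torus. If $\mathcal T$ is a component of $\partial M$, the boundary subgroups of $\pi_1(M,x)$ associated with $\mathcal T$ are the images of $\pi_1(\mathcal T,y)$, transported to $x$ along paths from $y\in\mathcal T$ to $x$. The group $\pi_1(M,x)$ is *given by its canonical presentation*: an identification $\pi(\sigma)\cong\pi_1(M,x)$ is given for which $h$ is the class of a regular fiber and, for a numbering $\mathcal T_1,\dots,\mathcal T_p$ of the components of $\partial M$, the subgroup $\langle d_k,h\rangle$ is a boundary subgroup associated with $\mathcal T_k$. Elements are given as words in the canonical generators. **Proposition 5.1.** The boundary parallelism problem is solvable in the group of a Seifert fibered space with non-empty boundary. Precisely, there is one algorithm (a total computable function) whose input consists of invariants $\sigma$ with $p\ge1$, an index $k\in\{1,\dots,p\}$ and two words $u,\omega$ in the canonical generators, and whose output is a finite list of pairs of integers, such that: 1. for all such $\sigma,k,u,\omega$, with $T=u\langle d_k,h\rangle u^{-1}\le\pi(\sigma)$, the elements $u\,d_k^{m}h^{n}u^{-1}$, $(m,n)$ in the output list, are exactly the elements of $$C_T(\omega)=\{t\in T : t\text{ is conjugate to }\omega\text{ in }\pi(\sigma)\};$$ 2. if $M$ is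 a Seifert fibered space with non-empty boundary whose group is given by its canonical presentation with invariants $\sigma$, then every boundary subgroup $T$ of $\pi_1(M,x)$ equals $u\langle d_k,h\rangle u^{-1}$ for some index $k$ and some word $u$, such that for every word $\omega$ the algorithm with input $(\sigma,k,u,\omega)$ lists in this way exactly the elements of $T$ that are conjugate to $\omega$ in $\pi_1(M,x)$. -/

import Mathlib

open scoped Manifold commutatorElement

/-! ## Seifert invariants and the canonical presentation -/

/-- Seifert invariants `(o or n, g, p, b | (α₁, β₁), …, (α_q, β_q))`: whether the base is orientable,
its genus `g`, the number `p` of its boundary components, the integer `b`, and the list of the types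
of the exceptional fibres. -/
structure SeifertInvariants where
  orientableBase : Bool
  g : ℕ
  p : ℕ
  b : ℤ
  exceptional : List (ℕ × ℕ)

namespace SeifertInvariants

/-- Invariants as tuples, which makes them admissible inputs of an algorithm. -/
def equivTuple : SeifertInvariants ≃ Bool × ℕ × ℕ × ℤ × List (ℕ × ℕ) where
  toFun σ := (σ.orientableBase, σ.g, σ.p, σ.b, σ.exceptional)
  invFun t := ⟨t.1, t.2.1, t.2.2.1, t.2.2.2.1, t.2.2.2.2⟩
  left_inv _ := rfl
  right_inv _ := rfl

instance : Primcodable SeifertInvariants :=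
  Primcodable.ofEquiv (Bool × ℕ × ℕ × ℤ × List (ℕ × ℕ)) equivTuple

/-- The conditions on the invariants: `0 < β < α` and `α, β` coprime for each exceptional fibre, and
a non-orientable base has genus at least `1`. -/
def IsValid (σ : SeifertInvariants) : Prop :=
  (∀ t ∈ σ.exceptional, 0 < t.2 ∧ t.2 < t.1 ∧ Nat.Coprime t.1 t.2) ∧
    (σ.orientableBase = false → 1 ≤ σ.g)

/-- The canonical generators `a_i` (`i < g`), `b_i` (`i < g`, only for an orientable base),
`c_j` (`j < q`), `d_k` (`k < p`) and `h`. -/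
inductive Gen (σ : SeifertInvariants) : Type
  | a (i : Fin σ.g) : Gen σ
  | b (i : Fin σ.g) (ho : σ.orientableBase = true) : Gen σ
  | c (j : Fin σ.exceptional.length) : Gen σ
  | d (k : Fin σ.p) : Gen σ
  | h : Gen σ

variable (σ : SeifertInvariants)

/-- `∏ [a_i, b_i]` if the base is orientable and `∏ a_i²` otherwise. -/
def surfaceWord : FreeGroup σ.Gen :=
  if ho : σ.orientableBase = true then
    (List.ofFn fun i : Fin σ.g => ⁅FreeGroup.of (Gen.a i), FreeGroup.of (Gen.b i ho)⁆).prod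
  else
    (List.ofFn fun i : Fin σ.g => FreeGroup.of (Gen.a i) ^ 2).prod

/-- The relators of the canonical presentation. -/
inductive IsRelator : FreeGroup σ.Gen → Prop
  | a_orientable (i : Fin σ.g) (ho : σ.orientableBase = true) :
      IsRelator ⁅FreeGroup.of (Gen.a i), FreeGroup.of Gen.h⁆
  | b_orientable (i : Fin σ.g) (ho : σ.orientableBase = true) :
      IsRelator ⁅FreeGroup.of (Gen.b i ho), FreeGroup.of Gen.h⁆
  /-- `a_i h a_i⁻¹ = h⁻¹` -/
  | a_nonorientable (i : Fin σ.g) (hn : σ.orientableBase = false) :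
      IsRelator (FreeGroup.of (Gen.a i) * FreeGroup.of Gen.h * (FreeGroup.of (Gen.a i))⁻¹ *
        FreeGroup.of Gen.h)
  | c_comm (j : Fin σ.exceptional.length) :
      IsRelator ⁅FreeGroup.of (Gen.c j), FreeGroup.of Gen.h⁆
  | d_comm (k : Fin σ.p) : IsRelator ⁅FreeGroup.of (Gen.d k), FreeGroup.of Gen.h⁆
  /-- `c_j ^ α_j = h ^ β_j` -/
  | c_pow (j : Fin σ.exceptional.length) :
      IsRelator (FreeGroup.of (Gen.c j) ^ (σ.exceptional.get j).1 *
        (FreeGroup.of Gen.h ^ (σ.exceptional.get j).2)⁻¹)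
  /-- `h ^ b = (∏ [a_i, b_i]) c_1 ⋯ c_q d_1 ⋯ d_p`, or the same with `∏ a_i²` -/
  | long :
      IsRelator ((FreeGroup.of Gen.h ^ σ.b)⁻¹ *
        (σ.surfaceWord * (List.ofFn fun j => FreeGroup.of (Gen.c j)).prod *
          (List.ofFn fun k => FreeGroup.of (Gen.d k)).prod))

/-- The group given by the canonical presentation. -/
abbrev Pi : Type := PresentedGroup {r | σ.IsRelator r}

variable {σ}

/-- The element of the group represented by a word `x₁^{±1} ⋯ x_n^{±1}` in the canonical generators;
`(x, true)` stands for `x` and `(x, false)` for `x⁻¹`. -/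
def wordVal (w : List (σ.Gen × Bool)) : σ.Pi :=
  PresentedGroup.mk _ (FreeGroup.mk w)

/-- The image of a canonical generator in the group. -/
def gen (x : σ.Gen) : σ.Pi := PresentedGroup.of x

/-- The peripheral subgroup `u ⟨d_k, h⟩ u⁻¹`. -/
def boundarySubgroup (k : Fin σ.p) (u : σ.Pi) : Subgroup σ.Pi :=
  (Subgroup.closure {gen (Gen.d k), gen Gen.h}).map (MulAut.conj u).toMonoidHom

/-- The element `u d_k^m h^n u⁻¹` of `u ⟨d_k, h⟩ u⁻¹`. -/
def boundaryElement (k : Fin σ.p) (u : σ.Pi) (m n : ℤ) : σ.Pi :=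
  u * (gen (Gen.d k) ^ m * gen Gen.h ^ n) * u⁻¹

/-- Name of a generator that does not depend on the invariants. -/
def Gen.code : σ.Gen → ℕ × ℕ
  | .a i => (0, i)
  | .b i _ => (1, i)
  | .c j => (2, j)
  | .d k => (3, k)
  | .h => (4, 0)

/-- A word in the canonical generators, as it is handed to an algorithm. -/
def codeWord (w : List (σ.Gen × Bool)) : List ((ℕ × ℕ) × Bool) :=
  w.map fun x => (x.1.code, x.2)

end SeifertInvariants

/-- The set of all elements of the subgroup `T` that are conjugate in `G` to `w`. -/
def conjugatesIn {G : Type*} [Group G] (T : Subgroup G) (w : G) : Set G :=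
  {t | t ∈ T ∧ IsConj w t}

/-! ## Seifert fibrations -/

/-- The solid torus `D² × S¹`. -/
abbrev SolidTorus : Type := Metric.closedBall (0 : ℂ) 1 × Circle

/-- Two points of the solid torus lie on the same fibre of the fibration of type `(μ, ν)`: the fibres
are the orbits of the action `l • (z, w) = (l ^ ν z, l ^ μ w)` of the circle. -/
def SolidTorus.SameFiber (μ : ℕ) (ν : ℤ) (x y : SolidTorus) : Prop :=
  ∃ l : Circle, (y.1 : ℂ) = ((l ^ ν : Circle) : ℂ) * (x.1 : ℂ) ∧ y.2 = l ^ μ * x.2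

/-- `φ` embeds the fibred solid torus of type `(μ, ν)` into `M` as a neighbourhood, saturated for the
equivalence relation `r`, of the class of `x`, and carries the fibres onto classes of `r`. -/
structure IsFiberedNhd {M : Type*} [TopologicalSpace M] (r : Setoid M) (x : M) (μ : ℕ) (ν : ℤ)
    (φ : SolidTorus → M) : Prop where
  pos : 0 < μ
  coprime : IsCoprime (μ : ℤ) ν
  isEmbedding : Topology.IsEmbedding φ
  mem_nhds : ∀ y, r x y → Set.range φ ∈ nhds y
  saturated : ∀ y ∈ Set.range φ, ∀ z, r y z → z ∈ Set.range φ
  fiber : ∀ v w, r (φ v) (φ w) ↔ SolidTorus.SameFiber μ ν v w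

/-- A Seifert fibration of `M`: a partition of `M` into fibres (the classes of an equivalence relation)
such that each fibre has a closed saturated neighbourhood that is fibre-preservingly homeomorphic to a
fibred solid torus. (A fibre in the boundary of `M` lies in the boundary of the solid torus.) -/
structure SeifertFibration (M : Type*) [TopologicalSpace M] where
  rel : Setoid M
  exists_nhd : ∀ x, ∃ (μ : ℕ) (ν : ℤ) (φ : SolidTorus → M), IsFiberedNhd rel x μ ν φ

namespace SeifertFibration

variable {M : Type*} [TopologicalSpace M]

/-- The fibre of `x` is regular: it has a trivially fibred (`μ = 1`) neighbourhood. -/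
def IsRegular (F : SeifertFibration M) (x : M) : Prop :=
  ∃ (ν : ℤ) (φ : SolidTorus → M), IsFiberedNhd F.rel x 1 ν φ

/-- The closed path `f` runs exactly once around the fibre of its base point. -/
def IsFiberLoop (F : SeifertFibration M) {y : M} (f : Path y y) : Prop :=
  Set.range f = {z | F.rel y z} ∧
    ∀ s t, f s = f t → s = t ∨ (s = 0 ∧ t = 1) ∨ (s = 1 ∧ t = 0)

end SeifertFibration

/-! ## Boundary subgroups -/

section Boundary

variable (M : Type*) [TopologicalSpace M] [ChartedSpace (EuclideanHalfSpace 3) M]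

/-- The boundary `∂M` of a 3-manifold, as a space. -/
abbrev Bdry : Type _ := ↥((𝓡∂ 3).boundary M)

/-- The inclusion of `∂M` in `M`. -/
def bdryIncl : C(Bdry M, M) := ⟨Subtype.val, continuous_subtype_val⟩

variable {M}

/-- The boundary subgroup of `π₁(M, x)` defined by the point `y` of `∂M` and the path `γ` from `y` to
`x`: the image of `π₁(𝒯, y)`, where `𝒯` is the component of `∂M` containing `y` (as `π₁(𝒯, y)` and
`π₁(∂M, y)` are the same group), transported to the base point `x` along `γ`. -/
noncomputable def boundarySubgroupOfPath {x : M} (y : Bdry M) (γ : Path (bdryIncl M y) x) :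
    Subgroup (FundamentalGroup M x) :=
  (FundamentalGroup.map (bdryIncl M) y).range.map
    (FundamentalGroup.fundamentalGroupMulEquivOfPath γ).toMonoidHom

/-- `T` is a boundary subgroup of `π₁(M, x)`. -/
def IsBoundarySubgroup {x : M} (T : Subgroup (FundamentalGroup M x)) : Prop :=
  ∃ (y : Bdry M) (γ : Path (bdryIncl M y) x), T = boundarySubgroupOfPath y γ

/-- The group `π₁(M, x)` of a Seifert fibred manifold is given by the canonical presentation with
invariants `σ`: the generators are named elements of `π₁(M, x)`, `h` is the class of a regular fibre,
and the components of `∂M` are numbered in such a way that `⟨d_k, h⟩` is a boundary subgroup associated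
with the `k`-th component. -/
structure CanonicalPresentation (F : SeifertFibration M) (x : M) (σ : SeifertInvariants) where
  toMulEquiv : σ.Pi ≃* FundamentalGroup M x
  h_eq : ∃ (y : M) (f : Path y y) (γ : Path y x), F.IsRegular y ∧ F.IsFiberLoop f ∧
    toMulEquiv (SeifertInvariants.gen .h) =
      FundamentalGroup.fundamentalGroupMulEquivOfPath γ (FundamentalGroup.fromPath ⟦f⟧)
  component : Fin σ.p ≃ ZerothHomotopy (Bdry M)
  boundary_eq : ∀ k, ∃ (y : Bdry M) (γ : Path (bdryIncl M y) x),
    Quotient.mk (pathSetoid (Bdry M)) y = component k ∧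
    (SeifertInvariants.boundarySubgroup k 1).map toMulEquiv.toMonoidHom = boundarySubgroupOfPath y γ

end Boundary

/-! Since `p ≥ 1`, the long relation can be solved for `d_k`: it says that `d_k⁻¹` equals, up to a
power of `h`, a word `W` (`longWord`) in the other generators. What remains is a group in which
`⟨h⟩` is normal and whose quotient by `⟨h⟩` is a free product of cyclic groups, infinite for `a_i`,
`b_i`, `d_j` with `j ≠ k`, and of order `α_j` for `c_j`. Elements therefore have computable normal
forms `h ^ n * l` with `l` a reduced word. That the normal form depends only on the element is
proved by letting the group act on all normal forms (`lift_codePerm_relator`); that it determines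
the element is `ofNF_normalForm`.

Reduced words are vertices of a tree on which the group acts by isometries (`dist_push`) and `h`
acts trivially. Unless the base is a disk with at most one exceptional point, all powers of `W` are
reduced as written, so `d_k` translates along an axis through the base vertex (`length_d_zpow`). If
`g ω g⁻¹ = d_k ^ m h ^ n` with `m ≠ 0`, then `g` may be replaced by the shortest `d_k ^ i g`, and
tree geometry bounds its length and `|m|` by the length of `ω` (`exists_short_conjugator`). For `m =
0` the conjugator `1` or one `a_i` suffices, because `h` is conjugate at most to `h` and `h⁻¹`. In
the disk case the group is abelian and a power of `d_k` lies in `⟨h⟩`.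

Thus a bounded search over conjugators `v` and exponents `m` decides everything
(`exists_bounded_conjugator`); `n` is read off a normal form. The conjugating word `u` is irrelevant
to conjugacy. For manifolds it remains to see that the boundary subgroups of one component are
conjugate (`exists_conj_range_mapEnd`). -/

namespace CyclicAmalgam

set_option linter.unusedSectionVars false

/-! ### Reduced words and multiplication by a generator -/

variable {ι : Type*} [DecidableEq ι]

/-- The exponent with which the word `l` starts in the generator `i` (as one letter). -/
def headExp (i : ι) (l : List (ι × ℕ)) : ℕ :=
  if l.head?.map Prod.fst = some i then (l.head?.map Prod.snd).getD 0 else 0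

/-- The word `l` without its initial letter in the generator `i`. -/
def headRest (i : ι) (l : List (ι × ℕ)) : List (ι × ℕ) :=
  if l.head?.map Prod.fst = some i then l.tail else l

/-- The word `i ^ e * l`. -/
def consExp (i : ι) (e : ℕ) (l : List (ι × ℕ)) : List (ι × ℕ) :=
  if e = 0 then l else (i, e) :: l

/-- The word part of the product of the generator `i` (or its inverse if `s` is false) of order `α`
(`0` standing for infinite order) with the reduced word `l`. -/
def push (α : ℕ) (i : ι) (s : Bool) (l : List (ι × ℕ)) : List (ι × ℕ) :=
  if α = 0 then
    -- For infinite order, a letter with exponent 1 is the generator and one with exponent 0 its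
    -- inverse, so the only possible reduction is a cancellation of one letter.
    if l.head? = some (i, (!s).toNat) then l.tail else (i, s.toNat) :: l
  else if s = true then
    consExp i (if headExp i l + 1 = α then 0 else headExp i l + 1) (headRest i l)
  else
    consExp i (if headExp i l = 0 then α - 1 else headExp i l - 1) (headRest i l)

/-- The exponent of the central element that splits off in `push`. -/
def carry (α : ℕ) (β : ℤ) (i : ι) (s : Bool) (l : List (ι × ℕ)) : ℤ :=
  if α = 0 then 0
  -- The wrap-around of the exponent uses `c ^ α = h ^ β`: passing from `α - 1` to `0` releases `h ^
  -- β`, and passing from `0` to `α - 1` releases `h ^ (-β)`.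
  else if s = true then (if headExp i l + 1 = α then β else 0)
  else (if headExp i l = 0 then -β else 0)

variable (ord : ι → ℕ) (tw : ι → ℤ) (neg : ι → Bool)

/-- Left multiplication of `h ^ n * l` by a generator or its inverse. -/
def act (i : ι) (s : Bool) (st : ℤ × List (ι × ℕ)) : ℤ × List (ι × ℕ) :=
  ((if neg i = true then -st.1 else st.1) + carry (ord i) (tw i) i s st.2, push (ord i) i s st.2)

/-- The admissible letters. -/
def IsLetter (x : ι × ℕ) : Prop := if ord x.1 = 0 then x.2 < 2 else 0 < x.2 ∧ x.2 < ord x.1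

/-- Two letters that may be adjacent in a reduced word. -/
def Compat (x y : ι × ℕ) : Prop := x.1 = y.1 → ord x.1 = 0 ∧ x.2 = y.2

/-- Reduced words. -/
def Reduced (l : List (ι × ℕ)) : Prop := (∀ x ∈ l, IsLetter ord x) ∧ l.IsChain (Compat ord)

variable {ord}

theorem reduced_nil : Reduced ord ([] : List (ι × ℕ)) := ⟨by simp, List.isChain_nil⟩

theorem reduced_cons {x : ι × ℕ} {l : List (ι × ℕ)} :
    Reduced ord (x :: l) ↔ IsLetter ord x ∧ (∀ y ∈ l.head?, Compat ord x y) ∧ Reduced ord l := by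
  simp only [Reduced, List.mem_cons, forall_eq_or_imp, List.isChain_cons]
  tauto

theorem reduced_consExp {i : ι} {e : ℕ} {l : List (ι × ℕ)} (hi : ord i ≠ 0) (he : e < ord i)
    (hl : l.head?.map Prod.fst ≠ some i) (h : Reduced ord l) : Reduced ord (consExp i e l) := by
  unfold consExp
  split_ifs with h0
  · exact h
  · refine reduced_cons.2 ⟨by simp [IsLetter, hi]; omega, fun y hy hiy => ?_, h⟩
    simp only [Option.mem_def] at hy
    simp_all

/-- This splitting `l = i ^ e * l'`, with `l'` not starting in `i`, reduces every computation in a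
factor of finite order to arithmetic of exponents modulo `ord i`. -/
theorem headRest_spec {i : ι} {l : List (ι × ℕ)} (hi : ord i ≠ 0) (h : Reduced ord l) :
    headExp i l < ord i ∧ (headRest i l).head?.map Prod.fst ≠ some i ∧ Reduced ord (headRest i l) ∧
      consExp i (headExp i l) (headRest i l) = l := by
  cases l with
  | nil => simp [headExp, headRest, consExp, reduced_nil]; omega
  | cons x l =>
    obtain ⟨j, e⟩ := x
    by_cases hj : j = i
    · subst hj
      obtain ⟨h1, h2, h3⟩ := reduced_cons.1 h
      simp only [IsLetter, hi, if_false] at h1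
      have h0 : e ≠ 0 := by omega
      simp only [headExp, headRest, consExp, List.head?_cons, Option.map_some, if_true,
        Option.getD_some, h0, if_false, List.tail_cons, and_true]
      refine ⟨h1.2, fun hm => ?_, h3⟩
      obtain ⟨y, hy, hyj⟩ := Option.map_eq_some_iff.1 hm
      exact hi (h2 y hy hyj.symm).1
    · simp [headExp, headRest, consExp, hj, h]; omega

theorem headExp_consExp {i : ι} {e : ℕ} {l : List (ι × ℕ)}
    (hl : l.head?.map Prod.fst ≠ some i) : headExp i (consExp i e l) = e := by
  unfold consExp headExp
  split_ifs <;> simp_all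

theorem headRest_consExp {i : ι} {e : ℕ} {l : List (ι × ℕ)}
    (hl : l.head?.map Prod.fst ≠ some i) : headRest i (consExp i e l) = l := by
  unfold consExp headRest
  split_ifs <;> simp_all

theorem isLetter_free {i : ι} (hi : ord i = 0) (s : Bool) : IsLetter ord (i, s.toNat) := by
  cases s <;> simp [IsLetter, hi]

theorem reduced_push (hord : ∀ i, ord i ≠ 1) (i : ι) (s : Bool) {l : List (ι × ℕ)}
    (h : Reduced ord l) : Reduced ord (push (ord i) i s l) := by
  unfold push
  split_ifs with h0 h1 h2 h3 h3
  · cases l with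
    | nil => simp at h1
    | cons x l => exact (reduced_cons.1 h).2.2
  · refine reduced_cons.2 ⟨isLetter_free h0 s, fun y hy hiy => ⟨h0, ?_⟩, h⟩
    have hy' : IsLetter ord y := h.1 y (List.mem_of_mem_head? hy)
    obtain ⟨j, e⟩ := y
    simp only at hiy
    subst hiy
    simp only [IsLetter, h0, if_true] at hy'
    have hne : e ≠ (!s).toNat := fun hh => h1 (by rw [← hh]; exact hy)
    cases s <;> simp at hne ⊢ <;> omega
  all_goals
    obtain ⟨p, q, r, -⟩ := headRest_spec h0 h
    have := hord i
    exact reduced_consExp h0 (by omega) q r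

/-- For infinite order, a letter is inserted and then cancelled, or the reverse; reducedness ensures
that a cancellation does not expose another cancelling letter. For finite order, the cyclic shift of
the exponent is undone, and an overflow in one direction is an underflow in the other, so the
carries are opposite. -/
theorem push_push (hord : ∀ i, ord i ≠ 1) (i : ι) (s : Bool) {l : List (ι × ℕ)}
    (h : Reduced ord l) : push (ord i) i (!s) (push (ord i) i s l) = l ∧
      carry (ord i) (tw i) i s l + carry (ord i) (tw i) i (!s) (push (ord i) i s l) = 0 := by
  by_cases h0 : ord i = 0
  · simp only [push, carry, h0, if_true, add_zero, and_true, Bool.not_not]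
    cases l with
    | nil => simp
    | cons x l =>
      by_cases hx : x = (i, (!s).toNat)
      · subst hx
        simp only [List.head?_cons, if_true, List.tail_cons]
        rw [if_neg]
        intro hl
        have := ((reduced_cons.1 h).2.1 _ hl rfl).2
        cases s <;> simp at this
      · simp [hx]
  · obtain ⟨p, q, r, t⟩ := headRest_spec h0 h
    have := hord i
    generalize headExp i l = e at *
    generalize headRest i l = l' at *
    subst t
    have h1 : ord i - 1 + 1 = ord i := by omega
    cases s <;>
    simp only [push, carry, h0, if_true, if_false, headExp_consExp q, headRest_consExp q,
      Bool.not_true, Bool.not_false, Bool.false_eq_true]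
    · by_cases he : e = 0
      · simp [he, h1]
      · have h2 : e - 1 + 1 = e := by omega
        have h3 : e ≠ ord i := by omega
        simp [he, h2, h3]
    · by_cases he : e + 1 = ord i
      · have h2 : ord i - 1 = e := by omega
        simp [he, h2]
      · simp [he]

-- A generator with a nonzero carry has finite order and commutes with `h` by `hneg`; otherwise its
-- carry would change sign before being cancelled.
variable {neg} in
theorem act_act (hord : ∀ i, ord i ≠ 1) (hneg : ∀ i, ord i ≠ 0 → neg i = false) (i : ι) (s : Bool)
    {st : ℤ × List (ι × ℕ)} (h : Reduced ord st.2) :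
    act ord tw neg i (!s) (act ord tw neg i s st) = st := by
  obtain ⟨h1, h2⟩ := push_push tw hord i s h
  refine Prod.ext ?_ h1
  simp only [act]
  by_cases h0 : ord i = 0
  · simp only [carry, h0, if_true, add_zero]
    split_ifs <;> simp
  · simp only [hneg i h0, Bool.false_eq_true, if_false, add_assoc, h2, add_zero]

/-! ### Overlap of words -/

variable (ord) in
/-- Twice the length of the common initial part of two words, where two different letters in a
generator of finite order count as half a common letter. -/
def sim : List (ι × ℕ) → List (ι × ℕ) → ℕ
  | x :: l, y :: m => if x = y then sim l m + 2 else if x.1 = y.1 ∧ ord x.1 ≠ 0 then 1 else 0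
  | _, _ => 0

@[simp] theorem sim_nil_left (l : List (ι × ℕ)) : sim ord [] l = 0 := by simp [sim]
@[simp] theorem sim_nil_right (l : List (ι × ℕ)) : sim ord l [] = 0 := by simp [sim]

theorem sim_comm (l m : List (ι × ℕ)) : sim ord l m = sim ord m l := by
  induction l generalizing m with
  | nil => simp
  | cons x l ih =>
    cases m with
    | nil => simp
    | cons y m =>
      by_cases h1 : x = y
      · subst h1; simp [sim, ih m]
      · by_cases h2 : x.1 = y.1
        · simp [sim, h1, Ne.symm h1, h2]
        · simp [sim, h1, Ne.symm h1, h2, Ne.symm h2]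

theorem sim_le (l m : List (ι × ℕ)) : sim ord l m ≤ 2 * l.length := by
  induction l generalizing m with
  | nil => simp
  | cons x l ih =>
    cases m with
    | nil => simp
    | cons y m =>
      have := ih m
      simp only [sim, List.length_cons]
      split_ifs <;> omega

/-- This is the 0-hyperbolic inequality for Gromov products: of three overlaps from a common base
vertex, the two smallest agree. -/
theorem min_sim_le (l m r : List (ι × ℕ)) : min (sim ord l m) (sim ord m r) ≤ sim ord l r := by
  induction l generalizing m r with
  | nil => simp
  | cons x l ih =>
    rcases m with _ | ⟨y, m⟩
    · simp
    rcases r with _ | ⟨z, r⟩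
    · simp
    have := ih m r
    simp only [sim]
    by_cases h1 : x = y <;> by_cases h2 : y = z
    · subst h1 h2; simp; omega
    · subst h1; simp [h2]
    · subst h2; simp [h1]
    · simp only [h1, h2, if_false]
      split_ifs <;> simp_all

/-- Left multiplication by a generator preserves the tree distance of reduced words. -/
theorem dist_push (hord : ∀ i, ord i ≠ 1) (i : ι) {l m : List (ι × ℕ)}
    (hl : Reduced ord l) (hm : Reduced ord m) :
    (push (ord i) i true l).length + (push (ord i) i true m).length + sim ord l m =
      l.length + m.length + sim ord (push (ord i) i true l) (push (ord i) i true m) := by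
  by_cases h0 : ord i = 0
  · have key : ∀ l m : List (ι × ℕ), Reduced ord l → l.head? = some (i, 0) →
        ¬ m.head? = some (i, 0) →
        sim ord l m = 0 ∧ sim ord l.tail ((i, 1) :: m) = 0 ∧ l.length = l.tail.length + 1 := by
      intro l m hl h1 h2
      cases l with
      | nil => simp at h1
      | cons x l =>
        simp only [List.head?_cons, Option.some.injEq] at h1
        subst h1
        refine ⟨?_, ?_, rfl⟩
        · cases m with
          | nil => simp
          | cons y m =>
            simp only [List.head?_cons, Option.some.injEq] at h2
            simp [sim, Ne.symm h2, h0]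
        · cases l with
          | nil => simp
          | cons y l =>
            have := (reduced_cons.1 hl).2.1 y rfl
            simp only [List.tail_cons, sim]
            obtain ⟨j, e⟩ := y
            by_cases hj : j = i
            · subst hj
              have := (this rfl).2
              simp only at this
              subst this
              simp [h0]
            · simp [hj]
    simp only [push, h0, if_true, Bool.not_true, Bool.toNat_false, Bool.toNat_true]
    split_ifs with h1 h2 h2
    · rcases l with _ | ⟨x, l⟩
      · simp at h1
      rcases m with _ | ⟨y, m⟩
      · simp at h2
      simp only [List.head?_cons, Option.some.injEq] at h1 h2
      subst h1 h2
      simp [sim]; omega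
    · obtain ⟨a, b, c⟩ := key l m hl h1 h2
      simp only [a, b, List.length_cons]; omega
    · obtain ⟨a, b, c⟩ := key m l hm h2 h1
      rw [sim_comm] at a b
      simp only [a, b, List.length_cons]; omega
    · simp [sim]; omega
  -- With distance meaning the sum of the lengths minus the overlap, `i ^ e * l` and `i ^ f * m` are
  -- at the distance of `l` and `m` if `e = f`, and at distance `l.length + m.length + 1` otherwise.
  -- The exponents enter only through the truth of `e = f`.
  · have key : ∀ (e f : ℕ) (l m : List (ι × ℕ)), l.head?.map Prod.fst ≠ some i →
        m.head?.map Prod.fst ≠ some i →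
        (consExp i e l).length + (consExp i f m).length + (if e = f then sim ord l m else 1) =
          l.length + m.length + sim ord (consExp i e l) (consExp i f m) + (if e = f then 0 else 2)
          := by
      intro e f l m hl hm
      have aux : ∀ (e : ℕ) (l m : List (ι × ℕ)), l.head?.map Prod.fst ≠ some i →
          sim ord l ((i, e) :: m) = 0 := by
        intro e l m hl
        cases l with
        | nil => simp
        | cons x l =>
          simp only [List.head?_cons, Option.map_some, ne_eq, Option.some.injEq] at hl
          have : x ≠ (i, e) := fun h => hl (by rw [h])
          simp [sim, this, hl]
      have aux' : ∀ (e : ℕ) (l m : List (ι × ℕ)), m.head?.map Prod.fst ≠ some i →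
          sim ord ((i, e) :: l) m = 0 := fun e l m hm => by rw [sim_comm, aux e m l hm]
      by_cases he : e = 0 <;> by_cases hf : f = 0
      · subst he hf; simp [consExp]
      · simp [consExp, he, hf, aux _ _ _ hl, Ne.symm hf]; omega
      · simp [consExp, he, hf, aux' _ _ _ hm]; omega
      · by_cases hef : e = f
        · subst hef; simp [consExp, he, sim]; omega
        · simp [consExp, he, hf, hef, sim, h0]; omega
    obtain ⟨a, b, -, c⟩ := headRest_spec h0 hl
    obtain ⟨a', b', -, c'⟩ := headRest_spec h0 hm
    have := hord i
    generalize headExp i l = e at *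
    generalize headRest i l = l' at *
    generalize headExp i m = f at *
    generalize headRest i m = m' at *
    subst c c'
    simp only [push, h0, if_true, if_false, headExp_consExp b, headRest_consExp b,
      headExp_consExp b', headRest_consExp b']
    have k1 := key e f l' m' b b'
    have k2 := key (if e + 1 = ord i then 0 else e + 1) (if f + 1 = ord i then 0 else f + 1)
      l' m' b b'
    -- The cyclic shift of exponents is injective, so both instances of `key` fall in the same case.
    have : (if e + 1 = ord i then 0 else e + 1) = (if f + 1 = ord i then 0 else f + 1) ↔ e = f := by
      by_cases h1 : e + 1 = ord i <;> by_cases h2 : f + 1 = ord i <;> simp [h1, h2] <;> omega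
    simp only [this] at k2
    omega

end CyclicAmalgam

/-! ## Length functions of tree type -/

/-- `len g` is the distance of `1` and `g` in a tree on which the group acts, and `s g g'` is twice
the length of the common part of the geodesics from `1` to `g` and `g'`. -/
structure IsTreeLength {G : Type*} [Group G] (len : G → ℕ) (s : G → G → ℕ) : Prop where
  len_one : len 1 = 0
  len_inv_mul : ∀ g g', len (g⁻¹ * g') + s g g' = len g + len g'
  comm : ∀ g g', s g g' = s g' g
  min_le : ∀ g g' g'', min (s g g') (s g' g'') ≤ s g g''
  le_two_mul : ∀ g g', s g g' ≤ 2 * len g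

namespace IsTreeLength

variable {G : Type*} [Group G] {len : G → ℕ} {s : G → G → ℕ} (H : IsTreeLength len s)
include H

theorem len_inv (g : G) : len g⁻¹ = len g := by
  have h1 := H.len_inv_mul g 1
  have h2 := H.le_two_mul 1 g
  rw [H.len_one, H.comm g 1] at *
  simp at h1 h2
  omega

theorem len_mul_le (g g' : G) : len (g * g') ≤ len g + len g' := by
  have h1 := H.len_inv_mul g⁻¹ g'
  rw [H.len_inv, inv_inv] at h1
  omega

theorem len_mul_of_len_eq_zero (g : G) {z : G} (hz : len z = 0) : len (g * z) = len g := by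
  have h1 := H.len_mul_le g z
  have h2 := H.len_mul_le (g * z) z⁻¹
  rw [H.len_inv, mul_inv_cancel_right] at h2
  omega

/-- A conjugator of `w` to a hyperbolic element `t` that is not shortened by `t` and `t⁻¹` has at
most half the length of `w`. -/
theorem two_mul_len_le {t w g : G} (h0 : 0 < len t) (h2 : len (t * t) = 2 * len t)
    (hg : len g ≤ len (t * g)) (hg' : len g ≤ len (t⁻¹ * g)) (hw : g * w * g⁻¹ = t) :
    2 * len g ≤ len w ∧ len t ≤ len w := by
  -- Since `len (t * t) = 2 * len t`, the overlap of `t⁻¹` and `t` is zero, so by `m1` the geodesic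
  -- to `g` leaves at once that to `t` or that to `t⁻¹`. In either case `m2` bounds the overlap of
  -- `g` and `t * g` by that of `t` and `g`, and `e4` expresses `len w` by this overlap. The
  -- hypotheses `hg` and `hg'` bound the overlaps of `g` with `t` and `t⁻¹` by `len t`.
  have e1 := H.len_inv_mul t⁻¹ t
  have e2 := H.len_inv_mul t g
  have e3 := H.len_inv_mul t⁻¹ g
  have e4 := H.len_inv_mul g (t * g)
  have e5 := H.len_inv_mul t (t * g)
  have e6 : g⁻¹ * (t * g) = w := by rw [← hw]; group
  have m1 := H.min_le t⁻¹ g t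
  have m2 := H.min_le t (t * g) g
  have c1 := H.comm g t
  have c2 := H.comm g (t * g)
  have l1 := H.le_two_mul g t
  have l2 := H.le_two_mul (t * g) t
  have c3 := H.comm (t * g) t
  rw [H.len_inv, inv_inv] at *
  rw [e6] at e4
  rw [inv_mul_cancel_left] at e5
  omega

/-- As `d` commutes with `d ^ m * h ^ n`, every `d ^ i * g` is again a conjugator. A shortest one is
not shortened by `d ^ m * h ^ n` or its inverse, because `h` does not affect lengths, so
`two_mul_len_le` applies. -/
theorem exists_short_conjugator {d h w g : G} {l : ℕ} (hl : 0 < l) (hh : ∀ n : ℤ, len (h ^ n) = 0)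
    (hdh : Commute d h) (hd : ∀ j : ℤ, len (d ^ j) = l * j.natAbs) {m n : ℤ} (hm : m ≠ 0)
    (hw : g * w * g⁻¹ = d ^ m * h ^ n) :
    ∃ g', g' * w * g'⁻¹ = d ^ m * h ^ n ∧ len g' ≤ len w ∧ m.natAbs ≤ len w := by
  obtain ⟨i, hi⟩ : ∃ i : ℤ, ∀ j : ℤ, len (d ^ i * g) ≤ len (d ^ j * g) :=
    ⟨_, fun j => Function.argmin_le (fun i : ℤ => len (d ^ i * g)) j⟩
  have hc : ∀ a b : ℤ, Commute (d ^ a) (h ^ b) := fun a b => hdh.zpow_zpow a b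
  have hlen : ∀ a b : ℤ, len (d ^ a * h ^ b) = l * a.natAbs := fun a b => by
    rw [H.len_mul_of_len_eq_zero _ (hh b), hd]
  have hlen' : ∀ (a b : ℤ) (x : G), len (d ^ a * h ^ b * x) = len (d ^ a * x) := fun a b x => by
    rw [← H.len_inv, ← H.len_inv (d ^ a * x), (hc a b).eq, mul_assoc, mul_inv_rev, ← zpow_neg,
      H.len_mul_of_len_eq_zero _ (hh _)]
  have key : d ^ i * g * w * (d ^ i * g)⁻¹ = d ^ m * h ^ n := by
    rw [show d ^ i * g * w * (d ^ i * g)⁻¹ = d ^ i * (g * w * g⁻¹) * (d ^ i)⁻¹ by group, hw,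
      ← mul_assoc, ← zpow_add, add_comm, zpow_add, mul_assoc, mul_assoc, ← (hc i n).inv_left.eq]
    group
  have hinv : (d ^ m * h ^ n)⁻¹ = d ^ (-m) * h ^ (-n) := by
    rw [mul_inv_rev, ← zpow_neg, ← zpow_neg, (hc _ _).eq]
  have hsq : d ^ m * h ^ n * (d ^ m * h ^ n) = d ^ (2 * m) * h ^ (2 * n) := by
    rw [two_mul, two_mul, zpow_add, zpow_add, (hc m n).mul_mul_mul_comm]
  have := H.two_mul_len_le (t := d ^ m * h ^ n) (w := w) (g := d ^ i * g)
    (by rw [hlen]; exact Nat.mul_pos hl (by omega))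
    (by rw [hsq, hlen, hlen, Int.natAbs_mul]; simp; ring)
    (by rw [hlen', ← mul_assoc, ← zpow_add]; exact hi _)
    (by rw [hinv, hlen', ← mul_assoc, ← zpow_add]; exact hi _) key
  refine ⟨d ^ i * g, key, by omega, ?_⟩
  rw [hlen] at this
  -- Here `l * m.natAbs ≤ len w`, and `l` is at least 1.
  nlinarith [this.2]

end IsTreeLength

/-! ### Permutations of the normal forms -/

namespace CyclicAmalgam

set_option linter.unusedSectionVars false

variable {ι : Type*} [DecidableEq ι] {ord : ι → ℕ} (tw : ι → ℤ) {neg : ι → Bool}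

/-- Normal forms `h ^ n * l` with `l` reduced. -/
abbrev NF (ord : ι → ℕ) : Type _ := {st : ℤ × List (ι × ℕ) // Reduced ord st.2}

/-- Left multiplication by a generator on the normal forms. -/
def genPerm (hord : ∀ i, ord i ≠ 1) (hneg : ∀ i, ord i ≠ 0 → neg i = false) (i : ι) :
    Equiv.Perm (NF ord) where
  toFun st := ⟨act ord tw neg i true st.1, reduced_push hord i true st.2⟩
  invFun st := ⟨act ord tw neg i false st.1, reduced_push hord i false st.2⟩
  left_inv st := Subtype.ext (act_act tw hord hneg i true st.2)
  right_inv st := Subtype.ext (act_act tw hord hneg i false st.2)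

variable (ord) in
/-- Multiplication by `h` on the normal forms. -/
def hPerm : Equiv.Perm (NF ord) where
  toFun st := ⟨(st.1.1 + 1, st.1.2), st.2⟩
  invFun st := ⟨(st.1.1 - 1, st.1.2), st.2⟩
  left_inv st := by simp
  right_inv st := by simp

theorem hPerm_zpow_apply (z : ℤ) (st : NF ord) :
    ((hPerm ord ^ z) st).1 = (st.1.1 + z, st.1.2) := by
  induction z using Int.induction_on generalizing st with
  | zero => simp
  | succ k ih => rw [zpow_add_one, Equiv.Perm.mul_apply, ih]; simp [hPerm]; ring
  | pred k ih =>
    rw [zpow_sub_one, Equiv.Perm.mul_apply, ih, Equiv.Perm.inv_def]; simp [hPerm]; ring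

variable (hord : ∀ i, ord i ≠ 1) (hneg : ∀ i, ord i ≠ 0 → neg i = false)

theorem genPerm_zpow_sign (i : ι) (s : Bool) (st : NF ord) :
    ((if s = true then genPerm tw hord hneg i else (genPerm tw hord hneg i)⁻¹) st).1 =
      act ord tw neg i s st.1 := by
  cases s <;> rfl

theorem genPerm_mul_hPerm (i : ι) :
    genPerm tw hord hneg i * hPerm ord =
      (if neg i = true then (hPerm ord)⁻¹ else hPerm ord) * genPerm tw hord hneg i := by
  ext1 st
  refine Subtype.ext ?_
  split_ifs with h
  · simp [genPerm, hPerm, act, h, Equiv.Perm.inv_def]; ring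
  · simp [genPerm, hPerm, act, h]; ring

theorem genPerm_pow_apply {i : ι} (hi : ord i ≠ 0) {st : NF ord}
    (hst : st.1.2.head?.map Prod.fst ≠ some i) (e : ℕ) (he : e < ord i) :
    ((genPerm tw hord hneg i ^ e) st).1 = (st.1.1, consExp i e st.1.2) := by
  induction e with
  | zero => simp [consExp]
  | succ e ih =>
    rw [pow_succ', Equiv.Perm.mul_apply]
    simp only [genPerm, Equiv.coe_fn_mk] at ih ⊢
    rw [ih (by omega)]
    have : e + 1 ≠ ord i := by omega
    simp [act, push, carry, hi, hneg i hi, headExp_consExp hst, headRest_consExp hst, this]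

/-- On a normal form whose word does not start in `i`, the powers of the generator count up through
`i ^ e` and the last step carries `tw i` once. Any other normal form is a power of the generator
applied to such a one, and that power commutes with `hPerm`. -/
theorem genPerm_pow_ord {i : ι} (hi : ord i ≠ 0) :
    genPerm tw hord hneg i ^ ord i = hPerm ord ^ tw i := by
  ext1 st
  obtain ⟨h1, h2, h3, h4⟩ := headRest_spec hi st.2
  set st₀ : NF ord := ⟨(st.1.1, headRest i st.1.2), h3⟩ with hst₀
  have e1 : (genPerm tw hord hneg i ^ headExp i st.1.2) st₀ = st :=
    Subtype.ext (by rw [genPerm_pow_apply tw hord hneg hi h2 _ h1, h4])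
  have e2 : (genPerm tw hord hneg i ^ ord i) st₀ = (hPerm ord ^ tw i) st₀ := by
    refine Subtype.ext ?_
    obtain ⟨a, ha⟩ : ∃ a, ord i = a + 1 := ⟨ord i - 1, by omega⟩
    rw [hPerm_zpow_apply, ha, pow_succ', Equiv.Perm.mul_apply]
    have := genPerm_pow_apply tw hord hneg hi (st := st₀) h2 a (by omega)
    simp only [genPerm, Equiv.coe_fn_mk] at this ⊢
    rw [this]
    simp [act, push, carry, hneg i hi, headExp_consExp h2, headRest_consExp h2, ha, hst₀]
    simp [consExp]
  have hc : Commute (genPerm tw hord hneg i) (hPerm ord) := by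
    have := genPerm_mul_hPerm tw hord hneg i
    rwa [hneg i hi, if_neg (by simp)] at this
  rw [← e1, ← Equiv.Perm.mul_apply, ← Equiv.Perm.mul_apply, ← pow_add, add_comm, pow_add,
    ← (hc.pow_left _).zpow_right, Equiv.Perm.mul_apply, e2, Equiv.Perm.mul_apply]

variable (ord) in
/-- The permutations of the normal forms that preserve the tree distance. -/
def isometries : Subgroup (Equiv.Perm (NF ord)) where
  carrier := {P | ∀ x y, (P x).1.2.length + (P y).1.2.length + sim ord x.1.2 y.1.2 =
    x.1.2.length + y.1.2.length + sim ord (P x).1.2 (P y).1.2}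
  one_mem' := fun x y => rfl
  mul_mem' := fun {P Q} hP hQ x y => by
    have h1 := hP (Q x) (Q y)
    have h2 := hQ x y
    simp only [Equiv.Perm.mul_apply]
    omega
  inv_mem' := fun {P} hP x y => by
    have h1 := hP (P⁻¹ x) (P⁻¹ y)
    simp only [← Equiv.Perm.mul_apply, mul_inv_cancel, Equiv.Perm.one_apply] at h1
    omega

theorem genPerm_mem_isometries (i : ι) : genPerm tw hord hneg i ∈ isometries ord :=
  fun x y => dist_push hord i x.2 y.2

theorem hPerm_mem_isometries : hPerm ord ∈ isometries ord := fun _ _ => rfl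

/-- The empty normal form. -/
def nilNF : NF ord := ⟨(0, []), reduced_nil⟩

/-- Lengths and overlaps are measured on the orbit of the empty word; `len_inv_mul` is the
invariance of the distance under `g⁻¹`. -/
theorem isTreeLength {G : Type*} [Group G] (Φ : G →* Equiv.Perm (NF ord))
    (hΦ : ∀ g, Φ g ∈ isometries ord) :
    IsTreeLength (fun g => (Φ g nilNF).1.2.length)
      (fun g g' => sim ord (Φ g nilNF).1.2 (Φ g' nilNF).1.2) where
  len_one := by simp [nilNF]
  len_inv_mul g g' := by
    have := hΦ g⁻¹ (Φ g nilNF) (Φ g' nilNF)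
    rw [← Equiv.Perm.mul_apply, ← Equiv.Perm.mul_apply, ← map_mul, ← map_mul, inv_mul_cancel,
      map_one] at this
    simpa [nilNF] using this
  comm g g' := sim_comm _ _
  min_le g g' g'' := min_sim_le _ _ _
  le_two_mul g g' := sim_le _ _

/-- The action of a word on a normal form. -/
def actWord (ord : ι → ℕ) (tw : ι → ℤ) (neg : ι → Bool) (w : List (ι × Bool))
    (st : ℤ × List (ι × ℕ)) : ℤ × List (ι × ℕ) :=
  w.foldr (fun x st => act ord tw neg x.1 x.2 st) st

/-- Words that are reduced as they stand. -/
def ReducedWord (ord : ι → ℕ) (w : List (ι × Bool)) : Prop :=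
  (∀ x ∈ w, ord x.1 ≠ 0 → x.2 = true) ∧
    w.IsChain fun x y => x.1 = y.1 → ord x.1 = 0 ∧ x.2 = y.2

-- No cancellation or wrap-around occurs while the word is multiplied out, so its length can be read
-- off. This gives the length of powers of `longWord`.
include hord in
theorem actWord_nil_of_reducedWord {w : List (ι × Bool)} (h : ReducedWord ord w) (n : ℤ) :
    (actWord ord tw neg w (n, [])).2 = w.map fun x => (x.1, x.2.toNat) := by
  induction w with
  | nil => rfl
  | cons x w ih =>
    obtain ⟨h1, h2⟩ := h
    rw [List.isChain_cons] at h2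
    have ih' := ih ⟨fun y hy => h1 y (by simp [hy]), h2.2⟩
    obtain ⟨i, s⟩ := x
    rw [show actWord ord tw neg ((i, s) :: w) (n, []) =
      act ord tw neg i s (actWord ord tw neg w (n, [])) from rfl]
    simp only [act, ih', List.map_cons]
    by_cases hi : ord i = 0
    · rw [push, if_pos hi, if_neg]
      cases w with
      | nil => simp
      | cons y w =>
        have := h2.1 y rfl
        intro hh
        simp only [List.map_cons, List.head?_cons, Option.some.injEq, Prod.mk.injEq] at hh
        have := (this hh.1.symm).2
        simp only at this
        rw [← this] at hh
        cases s <;> simp at hh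
    · have hs : s = true := h1 (i, s) (by simp) hi
      have hh : (w.map fun x => (x.1, x.2.toNat)).head?.map Prod.fst ≠ some i := by
        cases w with
        | nil => simp
        | cons y w =>
          have := h2.1 y rfl
          intro hh
          simp only [List.map_cons, List.head?_cons, Option.map_some, Option.some.injEq] at hh
          exact hi (this hh.symm).1
      have := hord i
      subst hs
      rw [push, if_neg hi, if_pos rfl]
      simp only [headExp, headRest, if_neg hh, zero_add, Ne.symm this, if_false]
      simp [consExp]

end CyclicAmalgam

namespace SeifertInvariants

open CyclicAmalgam

variable (σ : SeifertInvariants)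

/-! ## The canonical generators as factors of an amalgam -/

/-- The order of the generator with code `c` modulo `h`, with `0` for infinite order. -/
def codeOrd (c : ℕ × ℕ) : ℕ :=
  if c.1 = 2 then (σ.exceptional[c.2]?.map Prod.fst).getD 0 else 0

/-- The exponent `β` with `c ^ α = h ^ β`. -/
def codeTwist (c : ℕ × ℕ) : ℤ :=
  if c.1 = 2 then ((σ.exceptional[c.2]?.map Prod.snd).getD 0 : ℕ) else 0

/-- Whether the generator with code `c` inverts `h`. -/
def codeNeg (c : ℕ × ℕ) : Bool :=
  decide (c.1 = 0) && (!σ.orientableBase && decide (c.2 < σ.g))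

/-- The factors of `h ^ b * d_k⁻¹` in their order: each stands for `c_j`, `d_j`, `[a_i, b_i]` or
`a_i ^ 2`. -/
def keys (k : ℕ) : List (ℕ × ℕ) :=
  (List.range (σ.p - (k + 1))).map (fun j => (3, k + 1 + j)) ++
    ((List.range σ.g).map (fun i => (0, i)) ++
      ((List.range σ.exceptional.length).map (fun j => (2, j)) ++
        (List.range k).map (fun j => (3, j))))

/-- The word for a factor. -/
def piece (o : Bool) (c : ℕ × ℕ) : List ((ℕ × ℕ) × Bool) :=
  if c.1 = 0 then
    if o = true then [((0, c.2), true), ((1, c.2), true), ((0, c.2), false), ((1, c.2), false)]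
    else [((0, c.2), true), ((0, c.2), true)]
  else [(c, true)]

/-- A word for `h ^ b * d_k⁻¹` in which neither `h` nor `d_k` occurs. -/
def longWord (k : ℕ) : List ((ℕ × ℕ) × Bool) := (σ.keys k).flatMap (piece σ.orientableBase)

variable {σ}

/-- The generator with a given code. -/
def ofCode (c : ℕ × ℕ) : Option σ.Gen :=
  if h : c.1 = 0 ∧ c.2 < σ.g then some (.a ⟨c.2, h.2⟩)
  else if h : c.1 = 1 ∧ c.2 < σ.g ∧ σ.orientableBase = true then some (.b ⟨c.2, h.2.1⟩ h.2.2)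
  else if h : c.1 = 2 ∧ c.2 < σ.exceptional.length then some (.c ⟨c.2, h.2⟩)
  else if h : c.1 = 3 ∧ c.2 < σ.p then some (.d ⟨c.2, h.2⟩)
  else if c.1 = 4 ∧ c.2 = 0 then some .h
  else none

theorem ofCode_code (x : σ.Gen) : ofCode x.code = some x := by
  cases x <;> simp [ofCode, Gen.code]
  assumption

theorem code_of_ofCode {c : ℕ × ℕ} {x : σ.Gen} (h : ofCode c = some x) : x.code = c := by
  obtain ⟨c1, c2⟩ := c
  unfold ofCode at h
  split_ifs at h <;> simp at h <;> subst h <;>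
    simp only [Gen.code, Prod.mk.injEq, and_true] <;> simp only at * <;> omega

/-! ### Values of words and the elimination of `d_k` -/

variable {Γ : Type*} [Group Γ] (f : σ.Gen → Γ)

/-- The value of the generator with code `c` under an assignment of values to the generators. -/
def codeVal (c : ℕ × ℕ) : Γ := (ofCode c).elim 1 f

@[simp] theorem codeVal_code (x : σ.Gen) : codeVal f x.code = f x := by
  simp [codeVal, ofCode_code]

/-- The value of a word. -/
def evalWord (w : List ((ℕ × ℕ) × Bool)) : Γ :=
  (w.map fun x => cond x.2 (codeVal f x.1) (codeVal f x.1)⁻¹).prod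

@[simp] theorem evalWord_nil : evalWord f [] = 1 := rfl

@[simp] theorem evalWord_cons (x : (ℕ × ℕ) × Bool) (w : List ((ℕ × ℕ) × Bool)) :
    evalWord f (x :: w) = cond x.2 (codeVal f x.1) (codeVal f x.1)⁻¹ * evalWord f w := by
  simp [evalWord]

@[simp] theorem evalWord_append (w w' : List ((ℕ × ℕ) × Bool)) :
    evalWord f (w ++ w') = evalWord f w * evalWord f w' := by
  simp [evalWord]

theorem evalWord_invRev (w : List ((ℕ × ℕ) × Bool)) :
    evalWord f (FreeGroup.invRev w) = (evalWord f w)⁻¹ := by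
  induction w with
  | nil => simp
  | cons x w ih =>
    have : FreeGroup.invRev (x :: w) = FreeGroup.invRev w ++ [(x.1, !x.2)] := by
      simp [FreeGroup.invRev]
    rw [this, evalWord_append, ih]
    obtain ⟨c, s⟩ := x
    cases s <;> simp

theorem evalWord_codeWord (w : List (σ.Gen × Bool)) :
    evalWord f (codeWord w) = FreeGroup.lift f (FreeGroup.mk w) := by
  simp only [FreeGroup.lift_mk, evalWord, codeWord, List.map_map]
  congr 1
  refine List.map_congr_left fun x _ => ?_
  simp

theorem evalWord_flatMap (L : List (ℕ × ℕ)) (F : ℕ × ℕ → List ((ℕ × ℕ) × Bool)) :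
    evalWord f (L.flatMap F) = (L.map fun c => evalWord f (F c)).prod := by
  induction L with
  | nil => simp
  | cons c L ih => simp [ih]

theorem codeVal_a (i : Fin σ.g) : codeVal f (0, (i : ℕ)) = f (.a i) := codeVal_code f (.a i)
theorem codeVal_b (i : Fin σ.g) (ho : σ.orientableBase = true) :
    codeVal f (1, (i : ℕ)) = f (.b i ho) := codeVal_code f (.b i ho)
theorem codeVal_c (j : Fin σ.exceptional.length) : codeVal f (2, (j : ℕ)) = f (.c j) :=
  codeVal_code f (.c j)
theorem codeVal_d (j : Fin σ.p) : codeVal f (3, (j : ℕ)) = f (.d j) := codeVal_code f (.d j)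

theorem prod_map_range {n : ℕ} {F : ℕ → Γ} {G : Fin n → Γ} (h : ∀ i : Fin n, F i = G i) :
    ((List.range n).map F).prod = (List.ofFn G).prod := by
  congr 1
  refine List.ext_getElem (by simp) fun i h1 h2 => ?_
  have h3 : i < n := by simpa using h1
  simpa using h ⟨i, h3⟩

theorem lift_surfaceWord :
    FreeGroup.lift f σ.surfaceWord =
      ((List.range σ.g).map fun i => evalWord f (piece σ.orientableBase (0, i))).prod := by
  unfold surfaceWord
  split_ifs with ho
  · rw [map_list_prod, List.map_ofFn]
    refine (prod_map_range fun i => ?_).symm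
    simp [piece, ho, codeVal_a, codeVal_b f i ho, commutatorElement_def, mul_assoc]
  · rw [map_list_prod, List.map_ofFn]
    refine (prod_map_range fun i => ?_).symm
    simp [piece, ho, codeVal_a, pow_two]

/-- The long relation determines `d_k`. -/
theorem lift_long_eq_one_iff (k : Fin σ.p) (hc : ∀ j, Commute (f (.d j)) (f .h)) :
    FreeGroup.lift f ((FreeGroup.of Gen.h ^ σ.b)⁻¹ *
        (σ.surfaceWord * (List.ofFn fun j => FreeGroup.of (Gen.c j)).prod *
          (List.ofFn fun k => FreeGroup.of (Gen.d k)).prod)) = 1 ↔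
      f (.d k) = (evalWord f (σ.longWord k))⁻¹ * f .h ^ σ.b := by
  -- Let `Z` and `Y` be the products of the `d_j` before and after `d_k`. The relation `h ^ b = S C
  -- Z d_k Y` gives `d_k = (S C Z)⁻¹ h ^ b Y⁻¹`, and since `h ^ b` commutes with `Y` (`e3`), this is
  -- `(Y S C Z)⁻¹ h ^ b`. The word `longWord` spells `Y S C Z`.
  set L := List.ofFn fun j => f (.d j) with hL
  have hlen : (k : ℕ) < L.length := by simp [hL]
  have e1 : L.prod = (L.take k).prod * (f (.d k) * (L.drop (k + 1)).prod) := by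
    conv_lhs => rw [← List.take_append_drop k L, List.prod_append, List.drop_eq_getElem_cons hlen]
    simp [hL]
  have e2 : evalWord f (σ.longWord k) = (L.drop (k + 1)).prod * (FreeGroup.lift f σ.surfaceWord *
      ((List.ofFn fun j => f (.c j)).prod * (L.take k).prod)) := by
    simp only [longWord, keys, List.flatMap_append, evalWord_append, lift_surfaceWord]
    congr 1
    · rw [evalWord_flatMap, List.map_map]
      congr 1
      refine List.ext_getElem (by simp [hL]) fun i h1 h2 => ?_
      have h3 : k + 1 + i < σ.p := by simp at h1; omega
      simpa [hL, piece] using codeVal_d f ⟨_, h3⟩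
    congr 1
    · rw [evalWord_flatMap, List.map_map]; rfl
    congr 1
    · rw [evalWord_flatMap, List.map_map]
      refine prod_map_range fun j => ?_
      simp [piece, codeVal_c]
    · rw [evalWord_flatMap, List.map_map]
      congr 1
      refine List.ext_getElem (by simp [hL]) fun i h1 h2 => ?_
      have h3 : i < σ.p := by simp at h1; omega
      simpa [hL, piece] using codeVal_d f ⟨_, h3⟩
  have e3 : Commute (f .h ^ σ.b) (L.drop (k + 1)).prod := by
    refine Commute.list_prod_right _ _ fun y hy => ?_
    have hy' := List.mem_of_mem_drop hy
    simp only [hL, List.mem_ofFn] at hy'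
    obtain ⟨j, rfl⟩ := hy'
    exact ((hc j).symm.zpow_left _)
  rw [e2]
  simp only [map_mul, map_inv, map_zpow, FreeGroup.lift_apply_of, map_list_prod, List.map_ofFn]
  rw [show (List.ofFn (FreeGroup.lift f ∘ fun k => FreeGroup.of (Gen.d k))) = L by
      simp [hL, Function.comp_def],
    show (List.ofFn (FreeGroup.lift f ∘ fun k => FreeGroup.of (Gen.c k))) =
      List.ofFn fun j => f (.c j) by simp [Function.comp_def], e1]
  generalize (L.drop (k + 1)).prod = Y at *
  generalize (L.take k).prod = Z at *
  generalize (List.ofFn fun j => f (.c j)).prod = C at *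
  generalize FreeGroup.lift f σ.surfaceWord = S at *
  generalize f (.d k) = D at *
  generalize f .h ^ σ.b = t at *
  constructor
  · intro h
    have h' : t = S * C * (Z * (D * Y)) := by rwa [inv_mul_eq_one] at h
    have : D = (S * C * Z)⁻¹ * (t * Y⁻¹) := by rw [h']; group
    rw [this, e3.inv_right.eq]
    group
  · rintro rfl
    rw [inv_mul_eq_one, show S * C * (Z * ((Y * (S * (C * Z)))⁻¹ * t * Y)) = Y⁻¹ * (t * Y) by group,
      e3.eq]
    group

/-! ### The defining relations in the group -/

theorem mk_eq_lift (x : FreeGroup σ.Gen) :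
    (PresentedGroup.mk _ x : σ.Pi) = FreeGroup.lift gen x := by
  suffices h : PresentedGroup.mk {r | σ.IsRelator r} = FreeGroup.lift gen by rw [h]
  ext x
  simp [gen, PresentedGroup.of]

theorem wordVal_eq_evalWord (w : List (σ.Gen × Bool)) : wordVal w = evalWord gen (codeWord w) := by
  rw [evalWord_codeWord, wordVal, mk_eq_lift]

theorem lift_gen_relator {r : FreeGroup σ.Gen} (hr : σ.IsRelator r) :
    FreeGroup.lift (gen (σ := σ)) r = 1 := by
  rw [← mk_eq_lift]
  exact PresentedGroup.one_of_mem hr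

theorem gen_a_mul_h_of_orientable (i : Fin σ.g) (ho : σ.orientableBase = true) :
    Commute (gen (.a i)) (gen (σ := σ) .h) := by
  have := lift_gen_relator (.a_orientable i ho)
  rwa [map_commutatorElement, commutatorElement_eq_one_iff_commute, FreeGroup.lift_apply_of,
    FreeGroup.lift_apply_of] at this

theorem gen_b_mul_h (i : Fin σ.g) (ho : σ.orientableBase = true) :
    Commute (gen (.b i ho)) (gen (σ := σ) .h) := by
  have := lift_gen_relator (.b_orientable i ho)
  rwa [map_commutatorElement, commutatorElement_eq_one_iff_commute, FreeGroup.lift_apply_of,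
    FreeGroup.lift_apply_of] at this

theorem gen_a_mul_h_of_nonorientable (i : Fin σ.g) (hn : σ.orientableBase = false) :
    gen (.a i) * gen (σ := σ) .h = (gen .h)⁻¹ * gen (.a i) := by
  have := lift_gen_relator (.a_nonorientable i hn)
  simp only [map_mul, map_inv, FreeGroup.lift_apply_of] at this
  rw [← mul_inv_eq_iff_eq_mul]
  exact eq_inv_of_mul_eq_one_left this

theorem gen_c_mul_h (j : Fin σ.exceptional.length) :
    Commute (gen (.c j)) (gen (σ := σ) .h) := by
  have := lift_gen_relator (.c_comm j)
  rwa [map_commutatorElement, commutatorElement_eq_one_iff_commute, FreeGroup.lift_apply_of,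
    FreeGroup.lift_apply_of] at this

theorem gen_d_mul_h (j : Fin σ.p) : Commute (gen (.d j)) (gen (σ := σ) .h) := by
  have := lift_gen_relator (.d_comm j)
  rwa [map_commutatorElement, commutatorElement_eq_one_iff_commute, FreeGroup.lift_apply_of,
    FreeGroup.lift_apply_of] at this

theorem gen_c_pow (j : Fin σ.exceptional.length) :
    gen (σ := σ) (.c j) ^ (σ.exceptional.get j).1 = gen .h ^ (σ.exceptional.get j).2 := by
  have := lift_gen_relator (.c_pow j)
  simp only [map_mul, map_inv, map_pow, FreeGroup.lift_apply_of] at this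
  exact mul_inv_eq_one.1 this

theorem gen_d_eq (k : Fin σ.p) :
    gen (σ := σ) (.d k) = (evalWord gen (σ.longWord k))⁻¹ * gen .h ^ σ.b :=
  (lift_long_eq_one_iff gen k gen_d_mul_h).1 (lift_gen_relator .long)

theorem codeVal_gen_mul_h (c : ℕ × ℕ) :
    codeVal gen c * gen (σ := σ) .h =
      (if σ.codeNeg c = true then (gen .h)⁻¹ else gen .h) * codeVal gen c := by
  unfold codeVal
  rcases hx : ofCode (σ := σ) c with _ | x
  · have : σ.codeNeg c = false := by
      by_contra hn
      simp only [codeNeg, Bool.not_eq_false, Bool.and_eq_true, decide_eq_true_eq] at hn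
      simp [ofCode, hn.1, hn.2.2] at hx
    simp [this]
  · rw [← code_of_ofCode hx]
    cases x with
    | a i =>
      cases ho : σ.orientableBase
      · simpa [codeNeg, Gen.code, ho] using gen_a_mul_h_of_nonorientable i ho
      · simpa [codeNeg, Gen.code, ho] using (gen_a_mul_h_of_orientable i ho).eq
    | b i ho => simpa [codeNeg, Gen.code] using (gen_b_mul_h i ho).eq
    | c j => simpa [codeNeg, Gen.code] using (gen_c_mul_h j).eq
    | d j => simpa [codeNeg, Gen.code] using (gen_d_mul_h j).eq
    | h => simp [codeNeg, Gen.code]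

theorem codeVal_gen_pow (c : ℕ × ℕ) (hc : σ.codeOrd c ≠ 0) :
    codeVal (gen (σ := σ)) c ^ σ.codeOrd c = gen .h ^ σ.codeTwist c := by
  obtain ⟨c1, j⟩ := c
  by_cases h1 : c1 = 2
  · subst h1
    by_cases h2 : j < σ.exceptional.length
    · have := gen_c_pow (σ := σ) ⟨j, h2⟩
      rw [show codeVal (gen (σ := σ)) (2, j) = gen (.c ⟨j, h2⟩) from codeVal_c gen ⟨j, h2⟩]
      simpa [codeOrd, codeTwist, h2] using this
    · simp [codeOrd, h2] at hc
  · simp [codeOrd, h1] at hc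

end SeifertInvariants

namespace SeifertInvariants

open CyclicAmalgam

variable {σ : SeifertInvariants}

/-! ## The action of the group on the normal forms -/

/-- The code of a generator that is a factor of the amalgam, when `d_k` is eliminated. -/
def IsFactorCode (k : ℕ) (c : ℕ × ℕ) : Prop := c ≠ (4, 0) ∧ c ≠ (3, k) ∧ ∃ x : σ.Gen, x.code = c

theorem mem_keys {k : Fin σ.p} {c : ℕ × ℕ} : c ∈ σ.keys k ↔
    (c.1 = 3 ∧ c.2 < σ.p ∧ c.2 ≠ k) ∨ (c.1 = 0 ∧ c.2 < σ.g) ∨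
      (c.1 = 2 ∧ c.2 < σ.exceptional.length) := by
  obtain ⟨c1, c2⟩ := c
  have := k.2
  simp only [keys, List.mem_append, List.mem_map, List.mem_range, Prod.mk.injEq]
  constructor
  · rintro (⟨a, h1, h2, h3⟩ | ⟨a, h1, h2, h3⟩ | ⟨a, h1, h2, h3⟩ | ⟨a, h1, h2, h3⟩) <;> omega
  · rintro (⟨h1, h2, h3⟩ | ⟨h1, h2⟩ | ⟨h1, h2⟩)
    · rcases lt_or_gt_of_ne h3 with h | h
      · exact .inr (.inr (.inr ⟨c2, h, h1.symm, rfl⟩))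
      · exact .inl ⟨c2 - (k + 1), by omega, h1.symm, by omega⟩
    · exact .inr (.inl ⟨c2, h2, h1.symm, rfl⟩)
    · exact .inr (.inr (.inl ⟨c2, h2, h1.symm, rfl⟩))

theorem isFactorCode_of_mem_longWord {k : Fin σ.p} {x : (ℕ × ℕ) × Bool} (hx : x ∈ σ.longWord k) :
    IsFactorCode (σ := σ) k x.1 := by
  obtain ⟨c, hc, hx⟩ := List.mem_flatMap.1 hx
  rw [mem_keys] at hc
  obtain ⟨c1, c2⟩ := c
  simp only at hc
  rcases hc with ⟨rfl, h2, h3⟩ | ⟨rfl, h2⟩ | ⟨rfl, h2⟩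
  · simp [piece] at hx
    subst hx
    exact ⟨by simp, by simpa using h3, .d ⟨_, h2⟩, rfl⟩
  · have ha : IsFactorCode (σ := σ) k (0, c2) := ⟨by simp, by simp, .a ⟨_, h2⟩, rfl⟩
    cases ho : σ.orientableBase
    · simp [piece, ho] at hx
      subst hx
      exact ha
    · simp only [piece, ho, List.mem_cons, if_true, List.not_mem_nil, or_false] at hx
      have hb : IsFactorCode (σ := σ) k (1, c2) := ⟨by simp, by simp, .b ⟨_, h2⟩ ho, rfl⟩
      rcases hx with rfl | rfl | rfl | rfl <;> assumption
  · simp [piece] at hx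
    subst hx
    exact ⟨by simp, by simp, .c ⟨_, h2⟩, rfl⟩

theorem codeNeg_of_codeOrd_ne_zero (c : ℕ × ℕ) (hc : σ.codeOrd c ≠ 0) : σ.codeNeg c = false := by
  have : c.1 = 2 := by by_contra h; simp [codeOrd, h] at hc
  simp [codeNeg, this]

theorem IsValid.codeOrd_ne_one (hσ : σ.IsValid) (c : ℕ × ℕ) : σ.codeOrd c ≠ 1 := by
  unfold codeOrd
  split_ifs with h
  · by_cases hj : c.2 < σ.exceptional.length
    · have := hσ.1 _ (List.getElem_mem hj)
      simp [hj]
      omega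
    · simp [hj]
  · simp

/-- The action of a factor on the normal forms. -/
def factorPerm (hσ : σ.IsValid) (c : ℕ × ℕ) : Equiv.Perm (NF σ.codeOrd) :=
  genPerm σ.codeTwist hσ.codeOrd_ne_one codeNeg_of_codeOrd_ne_zero c

/-- The action of a word in the factors on the normal forms. -/
def wordPerm (hσ : σ.IsValid) (w : List ((ℕ × ℕ) × Bool)) : Equiv.Perm (NF σ.codeOrd) :=
  (w.map fun x => cond x.2 (factorPerm hσ x.1) (factorPerm hσ x.1)⁻¹).prod

theorem wordPerm_apply (hσ : σ.IsValid) (w : List ((ℕ × ℕ) × Bool)) (st : NF σ.codeOrd) :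
    (wordPerm hσ w st).1 = actWord σ.codeOrd σ.codeTwist σ.codeNeg w st.1 := by
  induction w with
  | nil => rfl
  | cons x w ih =>
    rw [wordPerm, List.map_cons, List.prod_cons, Equiv.Perm.mul_apply]
    rw [wordPerm] at ih
    obtain ⟨c, s⟩ := x
    have := genPerm_zpow_sign σ.codeTwist hσ.codeOrd_ne_one codeNeg_of_codeOrd_ne_zero c s
      ((w.map fun x => cond x.2 (factorPerm hσ x.1) (factorPerm hσ x.1)⁻¹).prod st)
    rw [ih] at this
    rw [show actWord σ.codeOrd σ.codeTwist σ.codeNeg ((c, s) :: w) st.1 =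
      act σ.codeOrd σ.codeTwist σ.codeNeg c s
        (actWord σ.codeOrd σ.codeTwist σ.codeNeg w st.1) from rfl, ← this]
    cases s <;> rfl

/-- The action of the generator with code `c`. -/
def codePerm (hσ : σ.IsValid) (k : ℕ) (c : ℕ × ℕ) : Equiv.Perm (NF σ.codeOrd) :=
  if c = (4, 0) then hPerm _
  else if c = (3, k) then (wordPerm hσ (σ.longWord k))⁻¹ * hPerm _ ^ σ.b
  else factorPerm hσ c

theorem factorPerm_mul_hPerm (hσ : σ.IsValid) (c : ℕ × ℕ) :
    factorPerm hσ c * hPerm _ =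
      (if σ.codeNeg c = true then (hPerm _)⁻¹ else hPerm _) * factorPerm hσ c :=
  genPerm_mul_hPerm _ _ _ _

theorem factorPerm_commute (hσ : σ.IsValid) {c : ℕ × ℕ} (hc : σ.codeNeg c = false) :
    Commute (factorPerm hσ c) (hPerm _) := by
  have := factorPerm_mul_hPerm hσ c
  rwa [hc, if_neg (by simp)] at this

/-- Over a non-orientable base each `a_i` inverts `h`, but it occurs in `longWord` only as `a_i ^
2`; all other factors commute with `h`. Hence the permutation assigned to `d_k` respects `[d_k, h] =
1`. -/
theorem longWord_commute (hσ : σ.IsValid) (k : ℕ) :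
    Commute (wordPerm hσ (σ.longWord k)) (hPerm _) := by
  have key : ∀ c, Commute (wordPerm hσ (piece σ.orientableBase c)) (hPerm _) := by
    intro c
    cases ho : σ.orientableBase
    · by_cases hc : c.1 = 0
      · simp only [piece, hc, if_true, Bool.false_eq_true, if_false, wordPerm, List.map_cons,
          List.map_nil, List.prod_cons, List.prod_nil, mul_one, cond_true]
        have := factorPerm_mul_hPerm hσ (0, c.2)
        split_ifs at this with h
        · have h1 : factorPerm hσ (0, c.2) * (hPerm _)⁻¹ = hPerm _ * factorPerm hσ (0, c.2) := by
            rw [mul_inv_eq_iff_eq_mul, mul_assoc, this, mul_inv_cancel_left]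
          rw [commute_iff_eq, mul_assoc, this, ← mul_assoc, h1, mul_assoc]
        · exact Commute.mul_left this this
      · simp only [piece, hc, if_false, wordPerm, List.map_cons,
          List.map_nil, List.prod_cons, List.prod_nil, mul_one, cond_true]
        exact factorPerm_commute hσ (by simp [codeNeg, hc])
    · have hf : ∀ c, Commute (factorPerm hσ c) (hPerm _) := fun c =>
        factorPerm_commute hσ (by simp [codeNeg, ho])
      refine Commute.list_prod_left _ _ fun y hy => ?_
      obtain ⟨x, -, rfl⟩ := List.mem_map.1 hy
      obtain ⟨c, s⟩ := x
      cases s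
      · exact (hf c).inv_left
      · exact hf c
  unfold longWord
  induction σ.keys k with
  | nil => exact Commute.one_left _
  | cons c L ih =>
    rw [List.flatMap_cons, wordPerm, List.map_append, List.prod_append]
    exact (key c).mul_left ih

theorem evalWord_codePerm {hσ : σ.IsValid} {k : Fin σ.p} :
    evalWord (fun x : σ.Gen => codePerm hσ k x.code) (σ.longWord k) =
      wordPerm hσ (σ.longWord k) := by
  unfold evalWord wordPerm
  congr 1
  refine List.map_congr_left fun x hx => ?_
  obtain ⟨h1, h2, y, hy⟩ := isFactorCode_of_mem_longWord hx
  rw [← hy] at h1 h2 ⊢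
  rw [codeVal_code, codePerm, if_neg h1, if_neg h2]

/-- The long relator acts trivially because the permutation of `d_k` is defined by solving it; this
is not circular, as `longWord` contains neither `d_k` nor `h`. The relator `c_j ^ α_j = h ^ β_j` is
`genPerm_pow_ord`. -/
theorem lift_codePerm_relator (hσ : σ.IsValid) (k : Fin σ.p) {r : FreeGroup σ.Gen}
    (hr : σ.IsRelator r) : FreeGroup.lift (fun x : σ.Gen => codePerm hσ k x.code) r = 1 := by
  have hh : codePerm hσ k (Gen.h (σ := σ)).code = hPerm _ := by simp [codePerm, Gen.code]
  have hd : ∀ j : Fin σ.p, Commute (codePerm hσ k (Gen.d j).code)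
      (codePerm hσ k (Gen.h (σ := σ)).code) := by
    intro j
    rw [hh, codePerm]
    split_ifs
    · exact Commute.refl _
    · exact (longWord_commute hσ k).inv_left.mul_left ((Commute.refl _).zpow_left _)
    · exact factorPerm_commute hσ (by simp [codeNeg, Gen.code])
  have hf : ∀ x : σ.Gen, x.code.1 ≠ 3 → x.code.1 ≠ 4 →
      codePerm hσ k x.code = factorPerm hσ x.code := by
    intro x h3 h4
    rw [codePerm, if_neg, if_neg]
    · intro h; simp [h] at h3
    · intro h; simp [h] at h4
  cases hr with
  | a_orientable i ho =>
    rw [map_commutatorElement, commutatorElement_eq_one_iff_commute, FreeGroup.lift_apply_of,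
      FreeGroup.lift_apply_of, hh, hf _ (by simp [Gen.code]) (by simp [Gen.code])]
    exact factorPerm_commute hσ (by simp [codeNeg, ho])
  | b_orientable i ho =>
    rw [map_commutatorElement, commutatorElement_eq_one_iff_commute, FreeGroup.lift_apply_of,
      FreeGroup.lift_apply_of, hh, hf _ (by simp [Gen.code]) (by simp [Gen.code])]
    exact factorPerm_commute hσ (by simp [codeNeg, ho])
  | a_nonorientable i hn =>
    simp only [map_mul, map_inv, FreeGroup.lift_apply_of, hh]
    rw [hf _ (by simp [Gen.code]) (by simp [Gen.code]), factorPerm_mul_hPerm,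
      if_pos (by simp [codeNeg, Gen.code, hn])]
    group
  | c_comm j =>
    rw [map_commutatorElement, commutatorElement_eq_one_iff_commute, FreeGroup.lift_apply_of,
      FreeGroup.lift_apply_of, hh, hf _ (by simp [Gen.code]) (by simp [Gen.code])]
    exact factorPerm_commute hσ (by simp [codeNeg, Gen.code])
  | d_comm j =>
    rw [map_commutatorElement, commutatorElement_eq_one_iff_commute, FreeGroup.lift_apply_of,
      FreeGroup.lift_apply_of]
    exact hd j
  | c_pow j =>
    simp only [map_mul, map_inv, map_pow, FreeGroup.lift_apply_of, hh]
    rw [hf _ (by simp [Gen.code]) (by simp [Gen.code]), mul_inv_eq_one, ← zpow_natCast (hPerm _)]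
    have h0 := hσ.1 _ (List.get_mem σ.exceptional j)
    have h1 : σ.codeOrd (Gen.c j).code = (σ.exceptional.get j).1 := by simp [codeOrd, Gen.code]
    have h2 : σ.codeTwist (Gen.c j).code = (σ.exceptional.get j).2 := by
      simp [codeTwist, Gen.code]
    rw [← h1, ← h2]
    exact genPerm_pow_ord _ _ _ (by rw [h1]; omega)
  | long =>
    rw [lift_long_eq_one_iff _ k hd, evalWord_codePerm, hh]
    simp [codePerm, Gen.code]

/-- The action of the group on the normal forms. -/
def toPerm (hσ : σ.IsValid) (k : Fin σ.p) : σ.Pi →* Equiv.Perm (NF σ.codeOrd) :=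
  PresentedGroup.toGroup fun _ hr => lift_codePerm_relator hσ k hr

theorem toPerm_gen (hσ : σ.IsValid) (k : Fin σ.p) (x : σ.Gen) :
    toPerm hσ k (gen x) = codePerm hσ k x.code :=
  PresentedGroup.toGroup.of _

theorem codePerm_mem_isometries (hσ : σ.IsValid) (k : ℕ) (c : ℕ × ℕ) :
    codePerm hσ k c ∈ isometries σ.codeOrd := by
  have hf : ∀ c, factorPerm hσ c ∈ isometries σ.codeOrd := fun c => genPerm_mem_isometries _ _ _ c
  unfold codePerm
  split_ifs
  · exact hPerm_mem_isometries
  · refine mul_mem (inv_mem (list_prod_mem fun y hy => ?_)) (zpow_mem hPerm_mem_isometries _)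
    obtain ⟨⟨c, s⟩, -, rfl⟩ := List.mem_map.1 hy
    cases s
    · exact inv_mem (hf c)
    · exact hf c
  · exact hf c

theorem toPerm_mem_isometries (hσ : σ.IsValid) (k : Fin σ.p) (g : σ.Pi) :
    toPerm hσ k g ∈ isometries σ.codeOrd :=
  PresentedGroup.generated_by _ ((isometries σ.codeOrd).comap (toPerm hσ k))
    (fun x => by
      rw [Subgroup.mem_comap]
      exact (toPerm_gen hσ k x).symm ▸ codePerm_mem_isometries hσ k x.code) g

/-! ### The computation of normal forms -/

variable (σ) in
/-- The action of a letter on a normal form, as it is computed. -/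
def actLetter (k : ℕ) (x : (ℕ × ℕ) × Bool) (st : ℤ × List ((ℕ × ℕ) × ℕ)) :
    ℤ × List ((ℕ × ℕ) × ℕ) :=
  if x.1 = (4, 0) then (st.1 + if x.2 = true then 1 else -1, st.2)
  else if x.1 = (3, k) then
    if x.2 = true then
      actWord σ.codeOrd σ.codeTwist σ.codeNeg (FreeGroup.invRev (σ.longWord k)) (st.1 + σ.b, st.2)
    else
      ((actWord σ.codeOrd σ.codeTwist σ.codeNeg (σ.longWord k) st).1 - σ.b,
        (actWord σ.codeOrd σ.codeTwist σ.codeNeg (σ.longWord k) st).2)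
  else act σ.codeOrd σ.codeTwist σ.codeNeg x.1 x.2 st

variable (σ) in
/-- The normal form of a word. -/
def normalForm (k : ℕ) (w : List ((ℕ × ℕ) × Bool)) : ℤ × List ((ℕ × ℕ) × ℕ) :=
  w.foldr (σ.actLetter k) (0, [])

theorem wordPerm_invRev (hσ : σ.IsValid) (w : List ((ℕ × ℕ) × Bool)) :
    wordPerm hσ (FreeGroup.invRev w) = (wordPerm hσ w)⁻¹ := by
  induction w with
  | nil => simp [wordPerm]
  | cons x w ih =>
    have : FreeGroup.invRev (x :: w) = FreeGroup.invRev w ++ [(x.1, !x.2)] := by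
      simp [FreeGroup.invRev]
    rw [wordPerm] at ih
    rw [wordPerm, this, List.map_append, List.prod_append, ih]
    obtain ⟨c, s⟩ := x
    cases s <;> simp [wordPerm]

theorem codePerm_apply (hσ : σ.IsValid) (k : ℕ) (x : (ℕ × ℕ) × Bool) (st : NF σ.codeOrd) :
    ((cond x.2 (codePerm hσ k x.1) (codePerm hσ k x.1)⁻¹) st).1 = σ.actLetter k x st.1 := by
  obtain ⟨c, s⟩ := x
  unfold codePerm actLetter
  simp only
  split_ifs with h1 h2 h3 h2
  · subst h2; rfl
  · rw [Bool.not_eq_true] at h2; subst h2; rfl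
  · subst h2
    rw [cond_true, Equiv.Perm.mul_apply, ← wordPerm_invRev, wordPerm_apply, hPerm_zpow_apply]
  · rw [Bool.not_eq_true] at h2
    subst h2
    rw [cond_false, mul_inv_rev, inv_inv, ← zpow_neg, Equiv.Perm.mul_apply, hPerm_zpow_apply,
      wordPerm_apply]
    rfl
  · cases s <;> rfl

/-- The computed normal form is the image of the empty one under the group element; hence words for
the same element have the same normal form. -/
theorem toPerm_wordVal_apply (hσ : σ.IsValid) (k : Fin σ.p) (w : List (σ.Gen × Bool)) :
    (toPerm hσ k (wordVal w) nilNF).1 = σ.normalForm k (codeWord w) := by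
  rw [wordVal_eq_evalWord]
  induction w with
  | nil => simp [codeWord, normalForm, nilNF]
  | cons x w ih =>
    have e1 : toPerm hσ k (cond x.2 (codeVal gen x.1.code) (codeVal gen x.1.code)⁻¹) =
        cond x.2 (codePerm hσ k x.1.code) (codePerm hσ k x.1.code)⁻¹ := by
      rw [codeVal_code]
      rcases x with ⟨x, s⟩
      cases s <;> simp [toPerm_gen]
    rw [codeWord, List.map_cons, evalWord_cons, map_mul, Equiv.Perm.mul_apply, e1,
      codePerm_apply hσ k (x.1.code, x.2)]
    rw [codeWord] at ih
    rw [ih]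
    rfl

/-! ### The element with a given normal form -/

/-- The element of a letter. -/
def letterVal (x : (ℕ × ℕ) × ℕ) : σ.Pi :=
  -- In infinite order the exponent 0 codes the inverse, not a zeroth power.
  if σ.codeOrd x.1 = 0 ∧ x.2 = 0 then (codeVal gen x.1)⁻¹ else codeVal gen x.1 ^ x.2

/-- The element with normal form `st`. -/
def ofNF (st : ℤ × List ((ℕ × ℕ) × ℕ)) : σ.Pi := gen .h ^ st.1 * (st.2.map letterVal).prod

theorem prod_consExp {c : ℕ × ℕ} (hc : σ.codeOrd c ≠ 0) (e : ℕ) (l : List ((ℕ × ℕ) × ℕ)) :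
    ((consExp c e l).map (letterVal (σ := σ))).prod =
      codeVal gen c ^ e * (l.map letterVal).prod := by
  unfold consExp
  split_ifs with h
  · simp [h]
  · simp [letterVal, hc]

theorem prod_headRest {c : ℕ × ℕ} (hc : σ.codeOrd c ≠ 0) (l : List ((ℕ × ℕ) × ℕ)) :
    codeVal gen c ^ headExp c l * ((headRest c l).map letterVal).prod =
      (l.map (letterVal (σ := σ))).prod := by
  cases l with
  | nil => simp [headExp, headRest]
  | cons x l =>
    obtain ⟨c', e⟩ := x
    by_cases h : c' = c
    · subst h
      simp [headExp, headRest, letterVal, hc]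
    · simp [headExp, headRest, h]

/-- Each rewriting step made by `act` is a consequence of the relations of the group, so it
multiplies the represented element by the letter. -/
theorem ofNF_act (c : ℕ × ℕ) (s : Bool) (st : ℤ × List ((ℕ × ℕ) × ℕ)) :
    ofNF (σ := σ) (act σ.codeOrd σ.codeTwist σ.codeNeg c s st) =
      cond s (codeVal gen c) (codeVal gen c)⁻¹ * ofNF st := by
  obtain ⟨n, l⟩ := st
  have hc := codeVal_gen_mul_h (σ := σ) c
  set v : σ.Pi := codeVal gen c with hv
  set h : σ.Pi := gen .h with hh
  have hconj : ∀ z : ℤ, cond s v v⁻¹ * h ^ z =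
      h ^ (if σ.codeNeg c = true then -z else z) * cond s v v⁻¹ := by
    have h1 : v * h * v⁻¹ = if σ.codeNeg c = true then h⁻¹ else h := by
      rw [hc, mul_inv_cancel_right]
    have h2 : ∀ z : ℤ, v * h ^ z * v⁻¹ = h ^ (if σ.codeNeg c = true then -z else z) := by
      intro z
      rw [← conj_zpow, h1]
      split_ifs <;> simp
    intro z
    cases s
    · have := h2 (if σ.codeNeg c = true then -z else z)
      rw [cond_false, inv_mul_eq_iff_eq_mul, ← mul_assoc, this]
      split_ifs <;> simp
    · rw [cond_true, ← h2, inv_mul_cancel_right]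
  -- It suffices to treat the word part: the power of `h` in front is moved across by `hconj`.
  have main : h ^ carry (σ.codeOrd c) (σ.codeTwist c) c s l *
      ((push (σ.codeOrd c) c s l).map letterVal).prod =
        cond s v v⁻¹ * (l.map letterVal).prod := by
    by_cases h0 : σ.codeOrd c = 0
    · simp only [carry, push, h0, if_true, zpow_zero, one_mul]
      split_ifs with h1
      · cases l with
        | nil => simp at h1
        | cons x l =>
          simp only [List.head?_cons, Option.some.injEq] at h1
          subst h1
          cases s <;> simp [letterVal, h0, hv]
      · cases s <;> simp [letterVal, h0, hv]
    · have hpow : v ^ σ.codeOrd c = h ^ σ.codeTwist c := codeVal_gen_pow c h0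
      rw [← prod_headRest h0 l]
      simp only [carry, push, h0, if_false]
      generalize headExp c l = e
      generalize headRest c l = l'
      cases s
      · simp only [Bool.false_eq_true, if_false, prod_consExp h0, cond_false, ← hv]
        by_cases he : e = 0
        · simp only [he, if_true, pow_zero, one_mul]
          rw [zpow_neg, ← hpow, ← mul_assoc]
          congr 1
          rw [inv_mul_eq_iff_eq_mul, ← pow_sub_one_mul h0, mul_inv_cancel_right]
        · simp only [he, if_false, zpow_zero, one_mul]
          rw [← mul_assoc]
          congr 1
          rw [eq_inv_mul_iff_mul_eq, ← pow_succ']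
          congr 1
          omega
      · simp only [if_true, prod_consExp h0, cond_true, ← hv]
        by_cases he : e + 1 = σ.codeOrd c
        · simp only [he, if_true, pow_zero, one_mul]
          rw [← hpow, ← mul_assoc, ← pow_succ', he]
        · simp only [he, if_false, zpow_zero, one_mul]
          rw [← mul_assoc, ← pow_succ']
  simp only [ofNF, act]
  rw [zpow_add, mul_assoc, main, ← mul_assoc, ← mul_assoc, hconj]

theorem ofNF_actWord (w : List ((ℕ × ℕ) × Bool)) (st : ℤ × List ((ℕ × ℕ) × ℕ)) :
    ofNF (σ := σ) (actWord σ.codeOrd σ.codeTwist σ.codeNeg w st) = evalWord gen w * ofNF st := by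
  induction w with
  | nil => simp [actWord]
  | cons x w ih =>
    rw [evalWord_cons, mul_assoc, ← ih, ← ofNF_act]
    rfl

theorem ofNF_add (z : ℤ) (st : ℤ × List ((ℕ × ℕ) × ℕ)) :
    ofNF (σ := σ) (z + st.1, st.2) = gen (σ := σ) .h ^ z * ofNF st := by
  simp [ofNF, zpow_add, mul_assoc]

theorem ofNF_actLetter (k : Fin σ.p) (x : (ℕ × ℕ) × Bool) (st : ℤ × List ((ℕ × ℕ) × ℕ)) :
    ofNF (σ := σ) (σ.actLetter k x st) = cond x.2 (codeVal gen x.1) (codeVal gen x.1)⁻¹ * ofNF st := by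
  obtain ⟨c, s⟩ := x
  have hd := gen_d_eq k
  unfold actLetter
  simp only
  split_ifs with h1 h2 h3 h2
  · subst h1 h2
    rw [add_comm, ofNF_add, zpow_one, show codeVal gen (4, 0) = gen (σ := σ) .h from
      codeVal_code gen Gen.h, cond_true]
  · rw [Bool.not_eq_true] at h2
    subst h1 h2
    rw [add_comm, ofNF_add, zpow_neg_one, show codeVal gen (4, 0) = gen (σ := σ) .h from
      codeVal_code gen Gen.h, cond_false]
  · subst h2 h3
    rw [ofNF_actWord, evalWord_invRev, add_comm, ofNF_add, ← mul_assoc, ← hd, cond_true, codeVal_d]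
  · rw [Bool.not_eq_true] at h2
    subst h2 h3
    rw [cond_false, codeVal_d, sub_eq_neg_add, ofNF_add, ofNF_actWord, hd, mul_inv_rev, inv_inv,
      zpow_neg, mul_assoc]
  · exact ofNF_act c s st

/-- A word can be recovered, as a group element, from its normal form. With `toPerm_wordVal_apply`
this solves the word problem. -/
theorem ofNF_normalForm (k : Fin σ.p) (w : List ((ℕ × ℕ) × Bool)) :
    ofNF (σ := σ) (σ.normalForm k w) = evalWord gen w := by
  induction w with
  | nil => simp [normalForm, ofNF]
  | cons x w ih =>
    rw [evalWord_cons, ← ih, ← ofNF_actLetter]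
    rfl

end SeifertInvariants

namespace SeifertInvariants

open CyclicAmalgam

variable {σ : SeifertInvariants}

/-! ## Bounds for conjugators -/

theorem length_push_le (α : ℕ) (c : ℕ × ℕ) (s : Bool) (l : List ((ℕ × ℕ) × ℕ)) :
    (push α c s l).length ≤ l.length + 1 := by
  have h1 : ∀ e, (consExp c e (headRest c l)).length ≤ l.length + 1 := fun e => by
    have : (headRest c l).length ≤ l.length := by
      unfold headRest; split_ifs <;> simp
    unfold consExp; split_ifs <;> simp <;> omega
  unfold push
  split_ifs <;> first | exact h1 _ | simp; try omega

theorem length_actWord_le (w : List ((ℕ × ℕ) × Bool)) (st : ℤ × List ((ℕ × ℕ) × ℕ)) :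
    (actWord σ.codeOrd σ.codeTwist σ.codeNeg w st).2.length ≤ w.length + st.2.length := by
  induction w with
  | nil => simp [actWord]
  | cons x w ih =>
    have := length_push_le (σ.codeOrd x.1) x.1 x.2
      (actWord σ.codeOrd σ.codeTwist σ.codeNeg w st).2
    rw [show (actWord σ.codeOrd σ.codeTwist σ.codeNeg (x :: w) st).2 =
      push (σ.codeOrd x.1) x.1 x.2 (actWord σ.codeOrd σ.codeTwist σ.codeNeg w st).2 from rfl,
      List.length_cons]
    omega

/-- A letter `d_k` is replaced by a word of the length of `longWord`; any other letter adds at most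
one. -/
theorem length_normalForm_le (k : ℕ) (w : List ((ℕ × ℕ) × Bool)) :
    (σ.normalForm k w).2.length ≤ ((σ.longWord k).length + 1) * w.length := by
  induction w with
  | nil => simp [normalForm]
  | cons x w ih =>
    have key : ∀ st : ℤ × List ((ℕ × ℕ) × ℕ),
        (σ.actLetter k x st).2.length ≤ (σ.longWord k).length + 1 + st.2.length := by
      intro st
      unfold actLetter
      split_ifs
      · simp
      · simp
      · have := length_actWord_le (σ := σ) (FreeGroup.invRev (σ.longWord k)) (st.1 + σ.b, st.2)
        have h2 : (FreeGroup.invRev (σ.longWord k)).length = (σ.longWord k).length := by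
          simp [FreeGroup.invRev]
        simp only [h2] at this
        omega
      · have := length_actWord_le (σ := σ) (σ.longWord k) st
        simp only
        omega
      · have := length_push_le (σ.codeOrd x.1) x.1 x.2 st.2
        simp only [act]
        omega
    have := key (σ.normalForm k w)
    rw [show σ.normalForm k (x :: w) = σ.actLetter k x (σ.normalForm k w) from rfl,
      List.length_cons, mul_add, mul_one]
    omega

theorem wordVal_surjective (g : σ.Pi) : ∃ w, wordVal w = g := by
  obtain ⟨x, rfl⟩ := PresentedGroup.mk_surjective _ g
  obtain ⟨w, rfl⟩ := Quot.exists_rep x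
  exact ⟨w, rfl⟩

theorem wordVal_append (v w : List (σ.Gen × Bool)) :
    wordVal (v ++ w) = wordVal v * wordVal w := by
  rw [wordVal, ← FreeGroup.mul_mk, map_mul]; rfl

@[simp] theorem wordVal_nil : wordVal ([] : List (σ.Gen × Bool)) = 1 := by
  rw [wordVal, ← FreeGroup.one_eq_mk, map_one]

theorem wordVal_singleton (x : σ.Gen) (s : Bool) :
    wordVal [(x, s)] = cond s (gen x) (gen x)⁻¹ := by
  rw [wordVal_eq_evalWord]
  simp [codeWord]

theorem wordVal_replicate (x : σ.Gen) (n : ℕ) :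
    wordVal (List.replicate n (x, true)) = gen x ^ n := by
  induction n with
  | zero => simp
  | succ n ih =>
    rw [List.replicate_succ', wordVal_append, ih, wordVal_singleton, pow_succ]; rfl

variable (σ) in
/-- A bound for the orders of the factors of finite order. -/
def ordBound : ℕ := σ.exceptional.foldr (fun t n => t.1 + n) 1

theorem one_le_ordBound : 1 ≤ σ.ordBound := by
  unfold ordBound
  generalize σ.exceptional = l
  induction l with
  | nil => simp
  | cons t l ih => simp only [List.foldr_cons]; omega

theorem le_ordBound {t : ℕ × ℕ} (ht : t ∈ σ.exceptional) : t.1 ≤ σ.ordBound := by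
  unfold ordBound
  generalize σ.exceptional = l at ht
  induction l with
  | nil => simp at ht
  | cons t' l ih =>
    rw [List.foldr_cons]
    rcases List.mem_cons.1 ht with rfl | h
    · omega
    · have := ih h; omega

theorem codeOrd_le_ordBound (c : ℕ × ℕ) : σ.codeOrd c ≤ σ.ordBound := by
  unfold codeOrd
  split_ifs
  · by_cases hj : c.2 < σ.exceptional.length
    · simpa [hj] using le_ordBound (List.getElem_mem hj)
    · simp [hj]
  · simp

/-- Converts a bound on the number of normal form letters into a bound on word length: a letter `c ^
e` costs `e < α` generators, and an infinite order letter costs at most one. -/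
theorem exists_wordVal_eq_prod (l : List ((ℕ × ℕ) × ℕ)) (hl : ∀ x ∈ l, IsLetter σ.codeOrd x) :
    ∃ v : List (σ.Gen × Bool), wordVal v = (l.map letterVal).prod ∧
      v.length ≤ l.length * σ.ordBound := by
  induction l with
  | nil => exact ⟨[], by simp, by simp⟩
  | cons x l ih =>
    obtain ⟨v, hv, hlen⟩ := ih fun y hy => hl y (by simp [hy])
    obtain ⟨u, hu, hulen⟩ : ∃ u : List (σ.Gen × Bool), wordVal u = letterVal x ∧
        u.length ≤ σ.ordBound := by
      obtain ⟨c, e⟩ := x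
      have hx : IsLetter σ.codeOrd (c, e) := hl _ (by simp)
      have h1 := one_le_ordBound (σ := σ)
      have h2 := codeOrd_le_ordBound (σ := σ) c
      simp only [IsLetter] at hx
      simp only [letterVal, codeVal]
      rcases ofCode c with _ | y
      · exact ⟨[], by simp, by simp⟩
      · split_ifs with h0
        · exact ⟨[(y, false)], wordVal_singleton y false, by simpa using h1⟩
        · refine ⟨List.replicate e (y, true), wordVal_replicate y e, ?_⟩
          rw [List.length_replicate]
          split_ifs at hx <;> omega
    refine ⟨u ++ v, by simp [wordVal_append, hu, hv], ?_⟩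
    rw [List.length_append, List.length_cons, add_mul, one_mul]
    omega

theorem ofNF_toPerm (hσ : σ.IsValid) (k : Fin σ.p) (g : σ.Pi) :
    ofNF (toPerm hσ k g nilNF).1 = g := by
  obtain ⟨w, rfl⟩ := wordVal_surjective g
  rw [toPerm_wordVal_apply, ofNF_normalForm, wordVal_eq_evalWord]

/-! ### Powers of a boundary element -/

theorem nodup_keys (k : Fin σ.p) : (σ.keys k).Nodup := by
  have hinj : ∀ a : ℕ, Function.Injective fun j : ℕ => (a, j) := fun a x y h => by simpa using h
  have hinj' : Function.Injective fun j : ℕ => (3, (k : ℕ) + 1 + j) := fun x y h => by simpa using h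
  simp only [keys, List.nodup_append', List.nodup_map_iff (hinj _), List.nodup_map_iff hinj',
    List.nodup_range, true_and, List.disjoint_left, List.mem_append, List.mem_map, List.mem_range]
  refine ⟨⟨?_, ?_⟩, ?_⟩
  · rintro _ ⟨a, ha, rfl⟩ ⟨b, hb, h⟩
    simp at h
  · rintro _ ⟨a, ha, rfl⟩ (⟨b, hb, h⟩ | ⟨b, hb, h⟩) <;> simp at h
  · rintro _ ⟨a, ha, rfl⟩ (⟨b, hb, h⟩ | ⟨b, hb, h⟩ | ⟨b, hb, h⟩) <;> simp at h
    omega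

theorem length_keys (k : Fin σ.p) :
    (σ.keys k).length + 1 = σ.g + σ.exceptional.length + σ.p := by
  have := k.2
  simp [keys]
  omega

variable (σ) in
/-- The base is a disk with at most one exceptional point. -/
def IsDisk : Prop := σ.g = 0 ∧ σ.exceptional.length ≤ 1 ∧ σ.p = 1

/-- Within one copy of `keys` no factor repeats, so equal neighbours can only meet at a seam, and
then `keys` is a single factor. If that factor is some `c_j`, then `g + q + p = 2`, which is an
excluded disk. -/
theorem isChain_keys_replicate (k : Fin σ.p) (hn : ¬ σ.IsDisk) (n : ℕ) :
    (List.replicate n (σ.keys k)).flatten.IsChain fun c c' => c = c' → c.1 ≠ 2 := by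
  have hlen := length_keys k
  have hk := k.2
  have hne : σ.keys k ≠ [] := fun h => hn ⟨by simp [h] at hlen; omega, by simp [h] at hlen; omega,
    by simp [h] at hlen; omega⟩
  rw [List.isChain_flatten]
  · constructor
    · intro l hl
      rw [List.eq_of_mem_replicate hl]
      exact (List.Pairwise.imp (fun h h' => absurd h' h) (nodup_keys k)).isChain
    -- At a seam the last factor `x` is also the first one; by `nodup_keys` it is then the only one.
    · refine (List.isChain_replicate_of_rel n ?_)
      rintro x hx y hy rfl h2
      have hxm : x ∈ σ.keys k := List.mem_of_mem_head? hy
      obtain ⟨l, hl⟩ : ∃ l, σ.keys k = x :: l := by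
        cases h : σ.keys k with
        | nil => exact absurd h hne
        | cons z l => rw [h] at hy; simp at hy; exact ⟨l, by rw [hy]⟩
      have hl0 : l = [] := by
        by_contra h
        rw [hl, List.getLast?_cons_of_ne_nil h] at hx
        have := nodup_keys k
        rw [hl] at this
        exact (List.nodup_cons.1 this).1 (List.mem_of_getLast? hx)
      rw [hl, hl0] at hlen
      have := (mem_keys (k := k) (c := x)).1 hxm
      refine hn ⟨?_, ?_, ?_⟩ <;> simp at hlen <;> omega
  · intro h
    exact hne (List.eq_of_mem_replicate h).symm

theorem codeOrd_eq_zero {c : ℕ × ℕ} (hc : c.1 ≠ 2) : σ.codeOrd c = 0 := by simp [codeOrd, hc]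

/-- Outside the disk case `longWord` is cyclically reduced: each piece is reduced, and consecutive
pieces do not interact. -/
theorem reducedWord_longWord_replicate (k : Fin σ.p) (hn : ¬ σ.IsDisk) (n : ℕ) :
    ReducedWord σ.codeOrd (List.replicate n (σ.longWord k)).flatten := by
  have hfl : (List.replicate n (σ.longWord k)).flatten =
      ((List.replicate n (σ.keys k)).flatten.map (piece σ.orientableBase)).flatten := by
    rw [List.map_flatten, List.map_replicate, longWord, List.flatMap]
    induction n with
    | zero => simp
    | succ n ih => simp [List.replicate_succ, ih]
  have hmem : ∀ c ∈ (List.replicate n (σ.keys k)).flatten, c ∈ σ.keys k := by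
    intro c hc
    obtain ⟨l, hl, hcl⟩ := List.mem_flatten.1 hc
    rwa [List.eq_of_mem_replicate hl] at hcl
  constructor
  · intro x hx h0
    rw [hfl] at hx
    obtain ⟨l, hl, hxl⟩ := List.mem_flatten.1 hx
    obtain ⟨c, hc, rfl⟩ := List.mem_map.1 hl
    by_contra hs
    unfold piece at hxl
    split_ifs at hxl
    · simp only [List.mem_cons, List.not_mem_nil, or_false] at hxl
      rcases hxl with rfl | rfl | rfl | rfl <;> exact h0 (codeOrd_eq_zero (by simp))
    · simp only [List.mem_cons, List.not_mem_nil, or_false] at hxl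
      rcases hxl with rfl | rfl <;> exact h0 (codeOrd_eq_zero (by simp))
    · simp only [List.mem_singleton] at hxl
      subst hxl
      simp at hs
  · rw [hfl, List.isChain_flatten, List.isChain_map]
    · constructor
      · intro l hl
        obtain ⟨c, -, rfl⟩ := List.mem_map.1 hl
        unfold piece
        split_ifs <;> simp [codeOrd]
      · refine List.IsChain.imp_of_mem_imp ?_ (isChain_keys_replicate k hn n)
        intro c c' hc hc' h x hx y hy hxy
        have h1 := mem_keys.1 (hmem c hc)
        have h2 := mem_keys.1 (hmem c' hc')
        obtain ⟨c1, c2⟩ := c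
        obtain ⟨d1, d2⟩ := c'
        simp only at h1 h2 h
        -- Every piece starts with the positive letter of its factor. A commutator ends in `b_i⁻¹`,
        -- whose generator starts no piece, and the other pieces end in a positive letter, so
        -- nothing cancels; merging would need two adjacent equal `c_j`.
        have hy' : y = ((d1, d2), true) := by
          unfold piece at hy
          split_ifs at hy <;> simp at hy <;> simp_all
        subst hy'
        unfold piece at hx
        split_ifs at hx with h3 h4
        · simp at hx
          subst hx
          simp at hxy
          omega
        · simp at hx
          subst hx
          exact ⟨codeOrd_eq_zero (by simp), rfl⟩
        · simp at hx
          subst hx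
          exact ⟨codeOrd_eq_zero (h hxy), rfl⟩
    · intro h
      obtain ⟨c, -, hc⟩ := List.mem_map.1 h
      unfold piece at hc
      split_ifs at hc

variable (hσ : σ.IsValid) (k : Fin σ.p)

theorem isTreeLength_toPerm : IsTreeLength
    (fun g => (toPerm hσ k g nilNF).1.2.length)
    (fun g g' => sim σ.codeOrd (toPerm hσ k g nilNF).1.2 (toPerm hσ k g' nilNF).1.2) :=
  isTreeLength _ (toPerm_mem_isometries hσ k)

theorem toPerm_h_zpow (n : ℤ) : toPerm hσ k (gen .h ^ n) = hPerm _ ^ n := by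
  rw [map_zpow, toPerm_gen]; simp [codePerm, Gen.code]

theorem toPerm_longWord : toPerm hσ k (evalWord gen (σ.longWord k)) =
    wordPerm hσ (σ.longWord k) := by
  have h := congrArg (toPerm hσ k) (gen_d_eq k)
  rw [toPerm_gen, map_mul, toPerm_h_zpow, map_inv, codePerm, if_neg (by simp [Gen.code]),
    if_pos (show (Gen.d k).code = (3, (k : ℕ)) from rfl)] at h
  exact (inv_injective (mul_right_cancel h)).symm

/-- Up to powers of `h`, which do not count, `d_k ^ (-n)` is the `n`-th power of `longWord`, and
this is reduced as written. Positive powers follow by inversion. -/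
theorem length_d_zpow (hn : ¬ σ.IsDisk) (j : ℤ) :
    (toPerm hσ k (gen (.d k) ^ j) nilNF).1.2.length = (σ.longWord k).length * j.natAbs := by
  have H := isTreeLength_toPerm hσ k
  have hW : Commute (evalWord gen (σ.longWord k)) (gen (σ := σ) .h) := by
    have h1 : evalWord gen (σ.longWord k) = gen (σ := σ) .h ^ σ.b * (gen (.d k))⁻¹ := by
      rw [gen_d_eq k]; group
    rw [h1]
    exact ((Commute.refl _).zpow_left _).mul_left (gen_d_mul_h k).inv_left
  have key : ∀ n : ℕ, (toPerm hσ k (gen (.d k) ^ (-(n : ℤ))) nilNF).1.2.length =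
      (σ.longWord k).length * n := by
    intro n
    have h1 : gen (σ := σ) (.d k) ^ (-(n : ℤ)) =
        evalWord gen (σ.longWord k) ^ n * gen .h ^ (-σ.b * n) := by
      rw [zpow_neg, ← inv_zpow, gen_d_eq k, mul_inv_rev, inv_inv, ← zpow_neg, zpow_natCast,
        (hW.zpow_right _).symm.mul_pow, ← zpow_natCast (gen (σ := σ) .h ^ (-σ.b)), ← zpow_mul,
        ((hW.pow_left n).zpow_right _).eq]
    rw [h1]
    clear h1
    refine (H.len_mul_of_len_eq_zero _ (z := gen .h ^ (-σ.b * n)) ?_).trans ?_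
    · simp only [toPerm_h_zpow, hPerm_zpow_apply]; rfl
    have h2 : wordPerm hσ (σ.longWord k) ^ n =
        wordPerm hσ (List.replicate n (σ.longWord k)).flatten := by
      induction n with
      | zero => simp [wordPerm]
      | succ n ih =>
        rw [pow_succ', ih, List.replicate_succ, List.flatten_cons]
        simp [wordPerm]
    simp only [map_pow, toPerm_longWord, h2, wordPerm_apply, nilNF]
    rw [actWord_nil_of_reducedWord σ.codeTwist hσ.codeOrd_ne_one
      (reducedWord_longWord_replicate k hn n)]
    simp [mul_comm]
  obtain ⟨n, rfl | rfl⟩ := Int.eq_nat_or_neg j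
  · rw [← key, zpow_neg]
    exact (H.len_inv _).symm
  · rw [key]; simp

end SeifertInvariants

/-! ### The disk case, conjugates of `h`, and the bounded search space -/

namespace SeifertInvariants

open CyclicAmalgam

variable {σ : SeifertInvariants}

theorem generators_of_isDisk (hd : σ.IsDisk) (k : Fin σ.p) (x : σ.Gen) :
    (∃ j, x = .c j) ∨ x = .d k ∨ x = .h := by
  cases x with
  | a i => exact absurd i.2 (by have := hd.1; omega)
  | b i ho => exact absurd i.2 (by have := hd.1; omega)
  | c j => exact .inl ⟨j, rfl⟩
  | d j =>
    have : j = k := Fin.ext (by have := j.2; have := k.2; have := hd.2.2; omega)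
    exact .inr (.inl (by rw [this]))
  | h => exact .inr (.inr rfl)

/-- The group is generated by `h`, `d_k` and at most one `c_j`; `h` commutes with the others, and
`d_k` is a word in `c_j` and `h`. -/
theorem commute_of_isDisk (hd : σ.IsDisk) (k : Fin σ.p) (g g' : σ.Pi) : Commute g g' := by
  have hcj : ∀ i j : Fin σ.exceptional.length, i = j := fun i j =>
    Fin.ext (by have := i.2; have := j.2; have := hd.2.1; omega)
  have hcd : ∀ j, Commute (gen (σ := σ) (.c j)) (gen (.d k)) := by
    intro j
    rw [gen_d_eq k]
    refine Commute.mul_right (Commute.inv_right ?_) ((gen_c_mul_h j).zpow_right _)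
    refine Commute.list_prod_right _ _ fun y hy => ?_
    obtain ⟨x, hx, rfl⟩ := List.mem_map.1 hy
    obtain ⟨h1, h2, z, hz⟩ := isFactorCode_of_mem_longWord hx
    have : Commute (gen (σ := σ) (.c j)) (codeVal gen x.1) := by
      rw [← hz, codeVal_code]
      rcases generators_of_isDisk hd k z with ⟨i, rfl⟩ | rfl | rfl
      · rw [hcj i j]
      · exact absurd hz.symm h2
      · exact absurd hz.symm h1
    cases x.2
    · exact this.inv_right
    · exact this
  have hgen : ∀ x y : σ.Gen, Commute (gen x) (gen y) := by
    intro x y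
    rcases generators_of_isDisk hd k x with ⟨i, rfl⟩ | rfl | rfl <;>
      rcases generators_of_isDisk hd k y with ⟨j, rfl⟩ | rfl | rfl
    · rw [hcj i j]
    · exact hcd i
    · exact gen_c_mul_h i
    · exact (hcd j).symm
    · exact Commute.refl _
    · exact gen_d_mul_h k
    · exact (gen_c_mul_h j).symm
    · exact (gen_d_mul_h k).symm
    · exact Commute.refl _
  have h1 : ∀ x : σ.Gen, ∀ g' : σ.Pi, Commute (gen x) g' := fun x g' =>
    Subgroup.mem_centralizer_singleton_iff.1 (PresentedGroup.generated_by _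
      (Subgroup.centralizer {gen x})
      (fun y => Subgroup.mem_centralizer_singleton_iff.2 (hgen x y).symm.eq) g') |>.symm
  exact (Subgroup.mem_centralizer_singleton_iff.1 (PresentedGroup.generated_by _
      (Subgroup.centralizer {g'})
      (fun y => Subgroup.mem_centralizer_singleton_iff.2 (h1 y g').eq) g))

/-- With an exceptional point, `d_k = c⁻¹ h ^ b`, so `d_k ^ α = h ^ (b α - β)`; without one, `d_k =
h ^ b`. This makes it possible to bound the exponent of `d_k` although `d_k` has no axis. -/
theorem exists_d_pow_of_isDisk (hσ : σ.IsValid) (hd : σ.IsDisk) (k : Fin σ.p) :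
    ∃ a : ℕ, 0 < a ∧ a ≤ σ.ordBound ∧ ∃ z : ℤ, gen (σ := σ) (.d k) ^ a = gen .h ^ z := by
  have hk : (k : ℕ) = 0 := by have := k.2; have := hd.2.2; omega
  have hkeys : σ.keys k = (List.range σ.exceptional.length).map fun j => (2, j) := by
    simp [keys, hk, hd.1, hd.2.2]
  rcases Nat.lt_or_ge 0 σ.exceptional.length with hq | hq
  · have hq1 : σ.exceptional.length = 1 := by have := hd.2.1; omega
    have hW : evalWord gen (σ.longWord k) = gen (σ := σ) (.c ⟨0, hq⟩) := by
      rw [longWord, hkeys, show List.range σ.exceptional.length = [0] by rw [hq1]; rfl]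
      simp only [List.map_cons, List.map_nil, List.flatMap_cons, List.flatMap_nil, List.append_nil,
        piece]
      simpa using codeVal_c gen ⟨0, hq⟩
    refine ⟨(σ.exceptional.get ⟨0, hq⟩).1, ?_, le_ordBound (List.get_mem _ _),
      σ.b * (σ.exceptional.get ⟨0, hq⟩).1 - (σ.exceptional.get ⟨0, hq⟩).2, ?_⟩
    · have := hσ.1 _ (List.get_mem σ.exceptional ⟨0, hq⟩)
      omega
    · rw [gen_d_eq k, hW, (commute_of_isDisk hd k _ _).mul_pow, inv_pow, gen_c_pow,
        ← zpow_natCast (_ ^ σ.b), ← zpow_mul, ← zpow_natCast, ← zpow_neg, ← zpow_add]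
      congr 1
      ring
  · refine ⟨1, one_pos, one_le_ordBound, σ.b, ?_⟩
    rw [gen_d_eq k, longWord, hkeys, Nat.le_zero.1 hq]
    simp

/-- Every generator conjugates `h` to `h` or `h⁻¹`. The second alternative records the
non-orientable base because it then provides some `a_i` that inverts `h`. -/
theorem conj_h (g : σ.Pi) : g * gen .h * g⁻¹ = gen .h ∨
    (σ.orientableBase = false ∧ g * gen .h * g⁻¹ = (gen .h)⁻¹) := by
  have hletter : ∀ (x : σ.Gen) (s : Bool), wordVal [(x, s)] * gen .h * (wordVal [(x, s)])⁻¹ =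
      gen .h ∨ (σ.orientableBase = false ∧
        wordVal [(x, s)] * gen .h * (wordVal [(x, s)])⁻¹ = (gen .h)⁻¹) := by
    intro x s
    have h := codeVal_gen_mul_h (σ := σ) x.code
    rw [codeVal_code] at h
    rw [wordVal_singleton]
    split_ifs at h with hn
    · have ho : σ.orientableBase = false := by
        simp only [codeNeg, Bool.and_eq_true, Bool.not_eq_true'] at hn
        exact hn.2.1
      refine .inr ⟨ho, ?_⟩
      cases s
      · rw [cond_false, inv_inv, mul_assoc, inv_mul_eq_iff_eq_mul, eq_mul_inv_iff_mul_eq, mul_assoc, h,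
          mul_inv_cancel_left]
      · rw [cond_true, h, mul_inv_cancel_right]
    · refine .inl ?_
      cases s
      · rw [cond_false, inv_inv, mul_assoc, inv_mul_eq_iff_eq_mul, h]
      · rw [cond_true, h, mul_inv_cancel_right]
  obtain ⟨w, rfl⟩ := wordVal_surjective g
  induction w with
  | nil => left; simp
  | cons x w ih =>
    obtain ⟨x, s⟩ := x
    rw [show (x, s) :: w = [(x, s)] ++ w from rfl, wordVal_append]
    have hx := hletter x s
    generalize wordVal [(x, s)] = u at *
    generalize wordVal w = v at *
    rw [show u * v * gen .h * (u * v)⁻¹ = u * (v * gen .h * v⁻¹) * u⁻¹ by group]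
    rcases ih with ih | ⟨ho, ih⟩ <;> rw [ih]
    · exact hx
    · rw [← conj_inv]
      rcases hx with hx | ⟨-, hx⟩ <;> rw [hx]
      · exact .inr ⟨ho, rfl⟩
      · exact .inl (inv_inv _)

variable (σ) in
/-- A bound for the conjugators and the exponents that have to be considered. -/
def searchBound (k n : ℕ) : ℕ := ((σ.longWord k).length + 1) * (n + 1) * σ.ordBound

/-- The exponents may change, but not the element they describe: in the disk case different pairs
give the same element, and a small one is chosen. -/
theorem exists_bounded_conjugator (hσ : σ.IsValid) (k : Fin σ.p) (w : List (σ.Gen × Bool))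
    (g : σ.Pi) (m n : ℤ) (hg : g * wordVal w * g⁻¹ = gen (.d k) ^ m * gen .h ^ n) :
    ∃ (v : List (σ.Gen × Bool)) (m' n' : ℤ),
      wordVal v * wordVal w * (wordVal v)⁻¹ = gen (.d k) ^ m' * gen .h ^ n' ∧
      gen (σ := σ) (.d k) ^ m' * gen .h ^ n' = gen (.d k) ^ m * gen .h ^ n ∧
      v.length ≤ σ.searchBound k w.length ∧ m'.natAbs ≤ σ.searchBound k w.length := by
  -- The `n + 1` in `searchBound` keeps the bound at least `ordBound`, hence positive, even for the
  -- empty word.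
  have hB : σ.ordBound ≤ σ.searchBound k w.length :=
    Nat.le_mul_of_pos_left _ (Nat.mul_pos (Nat.succ_pos _) (Nat.succ_pos _))
  have h1 := one_le_ordBound (σ := σ)
  by_cases hd : σ.IsDisk
  · obtain ⟨a, ha0, haB, z, hz⟩ := exists_d_pow_of_isDisk hσ hd k
    -- The exponent `m` is reduced modulo `a`, the quotient being absorbed into the power of `h`.
    have e : gen (σ := σ) (.d k) ^ (m % a) * gen .h ^ (z * (m / a) + n) =
        gen (.d k) ^ m * gen .h ^ n := by
      rw [zpow_add, zpow_mul, ← hz, ← zpow_natCast, ← zpow_mul, ← mul_assoc, ← zpow_add,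
        Int.emod_add_mul_ediv]
    refine ⟨[], m % a, z * (m / a) + n, ?_, e, by simp, ?_⟩
    · rw [e, ← hg, (commute_of_isDisk hd k g (wordVal w)).eq]
      simp
    · have := Int.emod_nonneg m (b := (a : ℤ)) (by omega)
      have := Int.emod_lt_of_pos m (b := (a : ℤ)) (by omega)
      omega
  -- Now `w` is a conjugate of `h ^ n`, hence `h ^ n` or `h ^ (-n)`. The empty conjugator works in
  -- the first case, and `a_i` with `i = 0` in the second.
  by_cases hm : m = 0
  · subst hm
    rw [zpow_zero, one_mul] at hg
    have hw : wordVal w = g⁻¹ * gen .h ^ n * g⁻¹⁻¹ := by rw [← hg]; group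
    rw [← conj_zpow] at hw
    rcases conj_h g⁻¹ with h2 | ⟨ho, h2⟩
    · refine ⟨[], 0, n, ?_, rfl, by simp, by simp⟩
      rw [hw, h2]; simp
    · have hg1 := hσ.2 ho
      refine ⟨[(.a ⟨0, hg1⟩, true)], 0, n, ?_, rfl, by simp; omega, by simp⟩
      have h3 := gen_a_mul_h_of_nonorientable (σ := σ) ⟨0, hg1⟩ ho
      have h4 : gen (σ := σ) (.a ⟨0, hg1⟩) * (gen .h)⁻¹ * (gen (.a ⟨0, hg1⟩))⁻¹ = gen .h := by
        rw [← conj_inv, h3, mul_inv_cancel_right, inv_inv]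
      rw [wordVal_singleton, cond_true, hw, h2, ← conj_zpow, h4, zpow_zero, one_mul]
  · have H := isTreeLength_toPerm hσ k
    have hl : 0 < (σ.longWord k).length := by
      have hlen := length_keys k
      have hk := k.2
      rcases hkeys : σ.keys k with _ | ⟨c, L⟩
      · rw [hkeys] at hlen
        simp at hlen
        exact absurd ⟨by omega, by omega, by omega⟩ hd
      · rw [longWord, hkeys, List.flatMap_cons, List.length_append]
        have : 0 < (piece σ.orientableBase c).length := by
          unfold piece; split_ifs <;> simp
        omega
    obtain ⟨g', hg', hlen, hm'⟩ := H.exists_short_conjugator (h := gen .h) hl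
      (fun n => by simp only [toPerm_h_zpow, hPerm_zpow_apply]; rfl) (gen_d_mul_h k)
      (length_d_zpow hσ k hd) hm hg
    have hlw := length_normalForm_le (σ := σ) k (codeWord w)
    have hcw : (codeWord w).length = w.length := by simp [codeWord]
    rw [← toPerm_wordVal_apply hσ k w, hcw] at hlw
    obtain ⟨v, hv, hvlen⟩ := exists_wordVal_eq_prod _ (toPerm hσ k g' nilNF).2.1
    -- The power `h ^ z` in front of the short conjugator has uncontrolled size, but it commutes
    -- with `d_k ^ m * h ^ n` and is dropped.
    have hg'' : g' = gen .h ^ (toPerm hσ k g' nilNF).1.1 * wordVal v := by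
      rw [hv]; exact (ofNF_toPerm hσ k g').symm
    generalize (toPerm hσ k g' nilNF).1.1 = z at hg''
    have hbound : (toPerm hσ k (wordVal w) nilNF).1.2.length * σ.ordBound ≤
        σ.searchBound k w.length := by
      refine Nat.mul_le_mul_right _ (hlw.trans (Nat.mul_le_mul_left _ (Nat.le_succ _)))
    refine ⟨v, m, n, ?_, rfl, ?_, ?_⟩
    · have h2 : wordVal v = gen .h ^ (-z) * g' := by rw [hg'']; group
      rw [h2, show gen .h ^ (-z) * g' * wordVal w * (gen .h ^ (-z) * g')⁻¹ =
        gen .h ^ (-z) * (g' * wordVal w * g'⁻¹) * (gen .h ^ (-z))⁻¹ by group, hg',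
        ← mul_assoc, ((gen_d_mul_h k).zpow_zpow m (-z)).symm.eq, mul_assoc, mul_assoc, ← mul_assoc
        (gen .h ^ (-z)), ((Commute.refl (gen (σ := σ) .h)).zpow_zpow (-z) n).eq]
      group
    · exact hvlen.trans ((Nat.mul_le_mul_right _ hlen).trans hbound)
    · exact hm'.trans ((Nat.le_mul_of_pos_right _ h1).trans hbound)

/-! ## The algorithm -/

variable (σ) in
/-- A list of letters that contains all letters of the canonical presentation. -/
def alphabet : List ((ℕ × ℕ) × Bool) :=
  (List.range 5).flatMap fun i =>
    (List.range (σ.g + σ.exceptional.length + σ.p + 1)).flatMap fun j =>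
      [((i, j), true), ((i, j), false)]

variable (σ) in
/-- The words of length at most `n` in the alphabet. -/
def wordsUpTo (n : ℕ) : List (List ((ℕ × ℕ) × Bool)) :=
  Nat.rec [[]] (fun _ L => [] :: L.flatMap fun w => σ.alphabet.map fun x => x :: w) n

theorem mem_alphabet (x : σ.Gen × Bool) : (x.1.code, x.2) ∈ σ.alphabet := by
  obtain ⟨x, s⟩ := x
  simp only [alphabet, List.mem_flatMap, List.mem_range]
  refine ⟨x.code.1, ?_, x.code.2, ?_, ?_⟩
  · cases x <;> simp [Gen.code]
  · cases x <;> simp [Gen.code] <;> omega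
  · cases s <;> simp

theorem codeWord_mem_wordsUpTo (v : List (σ.Gen × Bool)) (n : ℕ) (h : v.length ≤ n) :
    codeWord v ∈ σ.wordsUpTo n := by
  induction n generalizing v with
  | zero =>
    rw [List.eq_nil_of_length_eq_zero (Nat.le_zero.1 h)]
    simp [wordsUpTo, codeWord]
  | succ n ih =>
    change codeWord v ∈ [] :: (σ.wordsUpTo n).flatMap fun w => σ.alphabet.map fun x => x :: w
    cases v with
    | nil => simp [codeWord]
    | cons x v =>
      refine List.mem_cons_of_mem _ (List.mem_flatMap.2 ⟨codeWord v, ih v (by simpa using h), ?_⟩)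
      exact List.mem_map.2 ⟨_, mem_alphabet x, rfl⟩

variable (σ) in
/-- The word `v * w * v⁻¹ * d_k ^ (∓ m)`. -/
def testWord (k : ℕ) (w v : List ((ℕ × ℕ) × Bool)) (m : ℕ) (s : Bool) : List ((ℕ × ℕ) × Bool) :=
  v ++ (w ++ (FreeGroup.invRev v ++ (List.range m).map fun _ => ((3, k), !s)))

variable (σ) in
/-- The exponents of `d_k` and `h` if `v` conjugates `w` to an element `d_k ^ (± m) * h ^ n`. -/
def test (k : ℕ) (w v : List ((ℕ × ℕ) × Bool)) (m : ℕ) (s : Bool) : List (ℤ × ℤ) :=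
  -- An empty word part means `v * w * v⁻¹ * d_k ^ (∓ m) = h ^ n`; the exponent `n` is then the
  -- first component, so it needs no search.
  if (σ.normalForm k (testWord k w v m s)).2 = [] then
    [(if s = true then (m : ℤ) else -(m : ℤ), (σ.normalForm k (testWord k w v m s)).1)]
  else []

variable (σ) in
/-- The exponents of the elements `d_k ^ m * h ^ n` that are conjugate to `w`. -/
def search (k : ℕ) (w : List ((ℕ × ℕ) × Bool)) : List (ℤ × ℤ) :=
  (σ.wordsUpTo (σ.searchBound k w.length)).flatMap fun v =>
    (List.range (σ.searchBound k w.length + 1)).flatMap fun m =>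
      σ.test k w v m true ++ σ.test k w v m false

theorem evalWord_testWord (k : Fin σ.p) (w v : List ((ℕ × ℕ) × Bool)) (m : ℕ) (s : Bool) :
    evalWord gen (testWord k w v m s) = evalWord gen v * evalWord gen w * (evalWord gen v)⁻¹ *
      (gen (σ := σ) (.d k) ^ (if s = true then (m : ℤ) else -(m : ℤ)))⁻¹ := by
  have : evalWord gen ((List.range m).map fun _ => (((3, (k : ℕ)) : ℕ × ℕ), !s)) =
      (gen (σ := σ) (.d k) ^ (if s = true then (m : ℤ) else -(m : ℤ)))⁻¹ := by
    rw [evalWord, List.map_map, show (((fun x : (ℕ × ℕ) × Bool =>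
      cond x.2 (codeVal gen x.1) (codeVal gen x.1)⁻¹) ∘ fun _ : ℕ => ((3, (k : ℕ)), !s))) =
      fun _ => cond (!s) (gen (σ := σ) (.d k)) (gen (.d k))⁻¹ from
        funext fun _ => by simp [codeVal_d], List.map_const', List.prod_replicate, List.length_range]
    cases s <;> simp
  rw [testWord, evalWord_append, evalWord_append, evalWord_append, evalWord_invRev, this]
  simp [mul_assoc]

theorem mem_test_iff {k : Fin σ.p} {w v : List ((ℕ × ℕ) × Bool)} {m : ℕ} {s : Bool} {e : ℤ × ℤ} :
    e ∈ σ.test k w v m s ↔ (if s = true then (m : ℤ) else -(m : ℤ)) = e.1 ∧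
      σ.normalForm k (testWord k w v m s) = (e.2, []) := by
  obtain ⟨a, b⟩ := e
  unfold test
  by_cases h : (σ.normalForm k (testWord k w v m s)).2 = []
  · rw [if_pos h, List.mem_singleton, Prod.ext_iff, Prod.ext_iff]
    simp only [h, and_true]
    exact ⟨fun h => ⟨h.1.symm, h.2.symm⟩, fun h => ⟨h.1.symm, h.2.symm⟩⟩
  · rw [if_neg h, Prod.ext_iff]
    simp [h]

theorem conj_of_mem_test {k : Fin σ.p} {w v : List ((ℕ × ℕ) × Bool)} {m : ℕ} {s : Bool}
    {e : ℤ × ℤ} (h : e ∈ σ.test k w v m s) :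
    evalWord gen v * evalWord gen w * (evalWord gen v)⁻¹ =
      gen (σ := σ) (.d k) ^ e.1 * gen .h ^ e.2 := by
  obtain ⟨h1, h2⟩ := mem_test_iff.1 h
  have h3 := ofNF_normalForm k (testWord k w v m s)
  rw [h2, evalWord_testWord, h1, eq_mul_inv_iff_mul_eq] at h3
  rw [← h3, ((gen_d_mul_h k).zpow_zpow _ _).eq]
  simp [ofNF]

theorem mem_search_iff {k : Fin σ.p} {w : List ((ℕ × ℕ) × Bool)} {e : ℤ × ℤ} :
    e ∈ σ.search k w ↔ ∃ v ∈ σ.wordsUpTo (σ.searchBound k w.length),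
      ∃ m ≤ σ.searchBound k w.length, ∃ s, e ∈ σ.test k w v m s := by
  simp only [search, List.mem_flatMap, List.mem_range, List.mem_append, Nat.lt_succ_iff,
    Bool.exists_bool]
  simp only [or_comm]

theorem search_sound {k : Fin σ.p} {w : List (σ.Gen × Bool)} {e : ℤ × ℤ}
    (h : e ∈ σ.search k (codeWord w)) :
    IsConj (wordVal w) (gen (.d k) ^ e.1 * gen .h ^ e.2) := by
  obtain ⟨v, -, m, -, s, h⟩ := mem_search_iff.1 h
  rw [isConj_iff, wordVal_eq_evalWord]
  exact ⟨evalWord gen v, conj_of_mem_test h⟩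

/-- The bounded conjugator and exponent lie in the search range. The pair found may differ from `(m,
n)`, so only the elements are compared. -/
theorem search_complete (hσ : σ.IsValid) {k : Fin σ.p} {w : List (σ.Gen × Bool)} {m n : ℤ}
    (h : IsConj (wordVal w) (gen (.d k) ^ m * gen .h ^ n)) :
    ∃ e ∈ σ.search k (codeWord w),
      gen (σ := σ) (.d k) ^ e.1 * gen .h ^ e.2 = gen (.d k) ^ m * gen .h ^ n := by
  obtain ⟨g, hg⟩ := isConj_iff.1 h
  obtain ⟨v, m', n', h1, h2, h3, h4⟩ := exists_bounded_conjugator hσ k w g m n hg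
  have hlen : (codeWord w).length = w.length := by simp [codeWord]
  refine ⟨(m', n'), mem_search_iff.2 ⟨codeWord v, ?_, m'.natAbs, ?_, decide (0 ≤ m'), ?_⟩, h2⟩
  · rw [hlen]; exact codeWord_mem_wordsUpTo v _ h3
  · rwa [hlen]
  have hm : (if decide (0 ≤ m') = true then (m'.natAbs : ℤ) else -(m'.natAbs : ℤ)) = m' := by
    split_ifs with h <;> simp at h <;> omega
  refine mem_test_iff.2 ⟨hm, ?_⟩
  -- The test word is the code of a word in actual generators, so its normal form can be computed
  -- from its value `h ^ n'`.
  obtain ⟨u, hu⟩ : ∃ u : List (σ.Gen × Bool),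
      codeWord u = testWord k (codeWord w) (codeWord v) m'.natAbs (decide (0 ≤ m')) := by
    refine ⟨v ++ (w ++ (FreeGroup.invRev v ++
      (List.range m'.natAbs).map fun _ => (.d k, !decide (0 ≤ m')))), ?_⟩
    simp [codeWord, testWord, FreeGroup.invRev, Function.comp_def, Gen.code]
  have hval : wordVal u = gen .h ^ n' := by
    rw [wordVal_eq_evalWord, hu, evalWord_testWord, hm, ← wordVal_eq_evalWord,
      ← wordVal_eq_evalWord, h1, ((gen_d_mul_h k).zpow_zpow _ _).eq, mul_inv_cancel_right]
  rw [← hu, ← toPerm_wordVal_apply hσ, hval, toPerm_h_zpow, hPerm_zpow_apply]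
  simp [nilNF]

theorem mem_closure_d_h {k : Fin σ.p} {t : σ.Pi} :
    t ∈ Subgroup.closure {gen (.d k), gen (σ := σ) .h} ↔
      ∃ m n : ℤ, gen (.d k) ^ m * gen .h ^ n = t := by
  constructor
  · intro ht
    induction ht using Subgroup.closure_induction with
    | mem x hx =>
      rcases hx with rfl | rfl
      · exact ⟨1, 0, by simp⟩
      · exact ⟨0, 1, by simp⟩
    | one => exact ⟨0, 0, by simp⟩
    | mul x y _ _ hx hy =>
      obtain ⟨m, n, rfl⟩ := hx
      obtain ⟨m', n', rfl⟩ := hy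
      refine ⟨m + m', n + n', ?_⟩
      rw [zpow_add, zpow_add, ((gen_d_mul_h k).zpow_zpow m' n).mul_mul_mul_comm]
    | inv x _ hx =>
      obtain ⟨m, n, rfl⟩ := hx
      exact ⟨-m, -n, by rw [mul_inv_rev, zpow_neg, zpow_neg,
        ((gen_d_mul_h k).zpow_zpow m n).inv_inv.eq]⟩
  · rintro ⟨m, n, rfl⟩
    exact mul_mem (zpow_mem (Subgroup.subset_closure (by simp)) _)
      (zpow_mem (Subgroup.subset_closure (by simp)) _)

/-- Conjugation by `u` does not change conjugacy classes, so the exponents found for `⟨d_k, h⟩`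
serve for `u ⟨d_k, h⟩ u⁻¹`. -/
theorem setOf_search_eq_conjugatesIn (hσ : σ.IsValid) (k : Fin σ.p) (u : σ.Pi)
    (w : List (σ.Gen × Bool)) :
    {t | ∃ e ∈ σ.search k (codeWord w), t = boundaryElement k u e.1 e.2} =
      conjugatesIn (boundarySubgroup k u) (wordVal w) := by
  have hconj : ∀ t : σ.Pi, IsConj t (u * t * u⁻¹) := fun t => isConj_iff.2 ⟨u, rfl⟩
  ext t
  simp only [conjugatesIn, boundarySubgroup, Set.mem_ofPred_eq, Subgroup.mem_map, mem_closure_d_h]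
  constructor
  · rintro ⟨e, he, rfl⟩
    exact ⟨⟨_, ⟨e.1, e.2, rfl⟩, rfl⟩, (search_sound he).trans (hconj _)⟩
  · rintro ⟨⟨_, ⟨m, n, rfl⟩, rfl⟩, hc⟩
    obtain ⟨e, he, h⟩ := search_complete hσ (hc.trans (hconj (gen (.d k) ^ m * gen .h ^ n)).symm)
    exact ⟨e, he, by rw [boundaryElement, h]; rfl⟩

end SeifertInvariants

/-! ## Boundary subgroups of one component are conjugate -/

-- The conjugating element is the loop at `x` that runs back along `γ'`, then along the image of
-- `δ`, then along `γ`. Loops at `y` and at `y'` correspond to each other by conjugation with `δ`.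
open CategoryTheory in
theorem exists_conj_range_mapEnd {C D : Type*} [Groupoid C] [Groupoid D] (F : C ⥤ D) {y y' : C}
    {x : D} (δ : y' ⟶ y) (γ : F.obj y ≅ x) (γ' : F.obj y' ≅ x) :
    ∃ g : End x, (F.mapEnd y).range.map γ.conj.toMonoidHom =
      ((F.mapEnd y').range.map γ'.conj.toMonoidHom).map (MulAut.conj g).toMonoidHom := by
  let g : End x := γ'.inv ≫ F.map δ ≫ γ.hom
  have hg : g⁻¹ = γ.inv ≫ F.map (Groupoid.inv δ) ≫ γ'.hom := by
    refine inv_eq_of_mul_eq_one_right ?_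
    simp [g, End.mul_def, End.one_def]
  have key : ∀ a : End y, γ.conj (F.map a) =
      MulAut.conj g (γ'.conj (F.map (δ ≫ a ≫ Groupoid.inv δ))) := by
    intro a
    rw [MulAut.conj_apply, hg]
    simp [g, Iso.conj_apply, End.mul_def]
  refine ⟨g, ?_⟩
  ext t
  constructor
  · rintro ⟨_, ⟨a, rfl⟩, rfl⟩
    exact ⟨_, ⟨_, ⟨δ ≫ a ≫ Groupoid.inv δ, rfl⟩, rfl⟩, (key a).symm⟩
  · rintro ⟨_, ⟨_, ⟨a, rfl⟩, rfl⟩, rfl⟩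
    refine ⟨_, ⟨Groupoid.inv δ ≫ a ≫ δ, rfl⟩, (key _).trans ?_⟩
    simp

section

variable {M : Type*} [TopologicalSpace M] [ChartedSpace (EuclideanHalfSpace 3) M]

theorem exists_conj_boundarySubgroupOfPath {x : M} {y y' : Bdry M} (h : Joined y' y)
    (γ : Path (bdryIncl M y) x) (γ' : Path (bdryIncl M y') x) :
    ∃ g : FundamentalGroup M x, boundarySubgroupOfPath y γ =
      (boundarySubgroupOfPath y' γ').map (MulAut.conj g).toMonoidHom :=
  h.elim fun δ => exists_conj_range_mapEnd (FundamentalGroupoid.map (bdryIncl M))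
    (y := FundamentalGroupoid.mk y) (y' := FundamentalGroupoid.mk y')
    (x := FundamentalGroupoid.mk x) ⟦δ⟧ _ _

/-- The presentation provides one boundary subgroup for each component. Any other one of the same
component is conjugate to it, and the conjugating element is represented by a word. -/
theorem CanonicalPresentation.exists_eq_boundarySubgroup {F : SeifertFibration M} {x : M}
    {σ : SeifertInvariants} (P : CanonicalPresentation F x σ) {T : Subgroup (FundamentalGroup M x)}
    (hT : IsBoundarySubgroup T) : ∃ (k : Fin σ.p) (u : List (σ.Gen × Bool)),
      T = (SeifertInvariants.boundarySubgroup k (SeifertInvariants.wordVal u)).map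
        P.toMulEquiv.toMonoidHom := by
  obtain ⟨y, γ, rfl⟩ := hT
  obtain ⟨k, hk⟩ := P.component.surjective (Quotient.mk (pathSetoid (Bdry M)) y)
  obtain ⟨y', γ', hy', hb⟩ := P.boundary_eq k
  obtain ⟨g, hg⟩ := exists_conj_boundarySubgroupOfPath (Quotient.exact (hy'.trans hk)) γ γ'
  obtain ⟨u, hu⟩ := SeifertInvariants.wordVal_surjective (P.toMulEquiv.symm g)
  refine ⟨k, u, ?_⟩
  rw [hg, ← hb, hu, SeifertInvariants.boundarySubgroup, SeifertInvariants.boundarySubgroup,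
    Subgroup.map_map, Subgroup.map_map, Subgroup.map_map]
  congr 1
  ext t
  simp

theorem image_conjugatesIn {G G' : Type*} [Group G] [Group G'] (e : G ≃* G') (T : Subgroup G)
    (w : G) : e '' conjugatesIn T w = conjugatesIn (T.map e.toMonoidHom) (e w) := by
  have hc : ∀ t, IsConj (e w) (e t) ↔ IsConj w t := fun t =>
    ⟨fun h => by simpa using e.symm.toMonoidHom.map_isConj h, fun h => e.toMonoidHom.map_isConj h⟩
  ext t
  constructor
  · rintro ⟨t, ⟨ht, h⟩, rfl⟩
    exact ⟨⟨t, ht, rfl⟩, (hc t).2 h⟩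
  · rintro ⟨⟨t, ht, rfl⟩, h⟩
    exact ⟨t, ⟨ht, (hc t).1 h⟩, rfl⟩

end

/-! ## Integer arithmetic is primitive recursive -/

namespace Primrec

variable {α : Type*} [Primcodable α]

/-- Integers are encoded by `n ↦ 2 n` and `-(n + 1) ↦ 2 n + 1`; sign and absolute value are thus
read off by division by 2. -/
theorem int_ofNat {f : α → ℕ} (hf : Primrec f) : Primrec fun a => (f a : ℤ) := by
  refine Primrec.encode_iff.1 ((Primrec.nat_mul.comp (Primrec.const 2) hf).of_eq fun a => ?_)
  rfl

theorem int_negSucc {f : α → ℕ} (hf : Primrec f) : Primrec fun a => Int.negSucc (f a) := by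
  refine Primrec.encode_iff.1
    ((Primrec.succ.comp (Primrec.nat_mul.comp (Primrec.const 2) hf)).of_eq fun a => ?_)
  rfl

theorem int_toNat {f : α → ℤ} (hf : Primrec f) : Primrec fun a => (f a).toNat := by
  have he := Primrec.encode.comp hf
  refine (Primrec.ite (Primrec.eq.comp (Primrec.nat_mod.comp he (Primrec.const 2))
    (Primrec.const 0)) (Primrec.nat_div.comp he (Primrec.const 2)) (Primrec.const 0)).of_eq
      fun a => ?_
  rcases f a with n | n
  · rw [show Encodable.encode (Int.ofNat n) = 2 * n from rfl, if_pos (by omega)]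
    simp
  · rw [show Encodable.encode (Int.negSucc n) = 2 * n + 1 from rfl, if_neg (by omega)]
    rfl

theorem int_neg_toNat {f : α → ℤ} (hf : Primrec f) : Primrec fun a => (-f a).toNat := by
  have he := Primrec.encode.comp hf
  refine (Primrec.ite (Primrec.eq.comp (Primrec.nat_mod.comp he (Primrec.const 2))
    (Primrec.const 0)) (Primrec.const 0)
      (Primrec.succ.comp (Primrec.nat_div.comp he (Primrec.const 2)))).of_eq fun a => ?_
  rcases f a with n | n
  · rw [show Encodable.encode (Int.ofNat n) = 2 * n from rfl, if_pos (by omega)]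
    simp
  · rw [show Encodable.encode (Int.negSucc n) = 2 * n + 1 from rfl, if_neg (by omega)]
    simp only [Int.neg_negSucc]
    omega

/-- Sum and negation become differences of natural numbers once each integer is split into its
positive and negative parts. -/
theorem int_natCast_sub {f g : α → ℕ} (hf : Primrec f) (hg : Primrec g) :
    Primrec fun a => (f a : ℤ) - (g a : ℤ) := by
  refine (Primrec.ite (Primrec.nat_le.comp hg hf) (int_ofNat (Primrec.nat_sub.comp hf hg))
    (int_negSucc (Primrec.nat_sub.comp (Primrec.nat_sub.comp hg hf) (Primrec.const 1)))).of_eq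
      fun a => ?_
  split_ifs with h
  · omega
  · rw [Int.negSucc_eq]; omega

theorem int_add {f g : α → ℤ} (hf : Primrec f) (hg : Primrec g) :
    Primrec fun a => f a + g a :=
  (int_natCast_sub (Primrec.nat_add.comp (int_toNat hf) (int_toNat hg))
    (Primrec.nat_add.comp (int_neg_toNat hf) (int_neg_toNat hg))).of_eq fun a => by omega

theorem int_neg {f : α → ℤ} (hf : Primrec f) : Primrec fun a => -f a :=
  (int_natCast_sub (int_neg_toNat hf) (int_toNat hf)).of_eq fun a => by omega

theorem int_sub {f g : α → ℤ} (hf : Primrec f) (hg : Primrec g) :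
    Primrec fun a => f a - g a :=
  (int_add hf (int_neg hg)).of_eq fun a => by omega

end Primrec

/-! ## The algorithm is primitive recursive -/

namespace CyclicAmalgam

variable {α : Type*} [Primcodable α] {c : α → ℕ × ℕ} {l : α → List ((ℕ × ℕ) × ℕ)}

theorem primrec_head_fst (hl : Primrec l) : Primrec fun a => (l a).head?.map Prod.fst :=
  Primrec.option_map (Primrec.list_head?.comp hl) (Primrec.fst.comp Primrec.snd).to₂

theorem primrecPred_head_fst_eq (hc : Primrec c) (hl : Primrec l) :
    PrimrecPred fun a => (l a).head?.map Prod.fst = some (c a) :=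
  Primrec.eq.comp (primrec_head_fst hl) (Primrec.option_some.comp hc)

theorem primrec_headExp (hc : Primrec c) (hl : Primrec l) :
    Primrec fun a => headExp (c a) (l a) :=
  Primrec.ite (primrecPred_head_fst_eq hc hl)
    (Primrec.option_getD.comp (Primrec.option_map (Primrec.list_head?.comp hl)
      (Primrec.snd.comp Primrec.snd).to₂) (Primrec.const 0)) (Primrec.const 0)

theorem primrec_headRest (hc : Primrec c) (hl : Primrec l) :
    Primrec fun a => headRest (c a) (l a) :=
  Primrec.ite (primrecPred_head_fst_eq hc hl) (Primrec.list_tail.comp hl) hl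

theorem primrec_consExp {e : α → ℕ} (hc : Primrec c) (he : Primrec e) (hl : Primrec l) :
    Primrec fun a => consExp (c a) (e a) (l a) :=
  Primrec.ite (Primrec.eq.comp he (Primrec.const 0)) hl
    (Primrec.list_cons.comp (Primrec.pair hc he) hl)

variable {o : α → ℕ} {t : α → ℤ} {s : α → Bool}

theorem primrec_bool_toNat (hs : Primrec s) : Primrec fun a => (s a).toNat :=
  (Primrec.dom_bool Bool.toNat).comp hs

theorem primrec_push (ho : Primrec o) (hc : Primrec c) (hs : Primrec s) (hl : Primrec l) :
    Primrec fun a => push (o a) (c a) (s a) (l a) := by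
  have he := primrec_headExp hc hl
  have hr := primrec_headRest hc hl
  refine Primrec.ite (Primrec.eq.comp ho (Primrec.const 0))
    (Primrec.ite (Primrec.eq.comp (Primrec.list_head?.comp hl) (Primrec.option_some.comp
      (Primrec.pair hc (primrec_bool_toNat (Primrec.not.comp hs))))) (Primrec.list_tail.comp hl)
      (Primrec.list_cons.comp (Primrec.pair hc (primrec_bool_toNat hs)) hl))
    (Primrec.ite (Primrec.eq.comp hs (Primrec.const true))
      (primrec_consExp hc (Primrec.ite (Primrec.eq.comp (Primrec.succ.comp he) ho)
        (Primrec.const 0) (Primrec.succ.comp he)) hr)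
      (primrec_consExp hc (Primrec.ite (Primrec.eq.comp he (Primrec.const 0))
        (Primrec.nat_sub.comp ho (Primrec.const 1))
        (Primrec.nat_sub.comp he (Primrec.const 1))) hr))

theorem primrec_carry (ho : Primrec o) (ht : Primrec t) (hc : Primrec c) (hs : Primrec s)
    (hl : Primrec l) : Primrec fun a => carry (o a) (t a) (c a) (s a) (l a) := by
  have he := primrec_headExp hc hl
  exact Primrec.ite (Primrec.eq.comp ho (Primrec.const 0)) (Primrec.const 0)
    (Primrec.ite (Primrec.eq.comp hs (Primrec.const true))
      (Primrec.ite (Primrec.eq.comp (Primrec.succ.comp he) ho) ht (Primrec.const 0))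
      (Primrec.ite (Primrec.eq.comp he (Primrec.const 0)) (Primrec.int_neg ht)
        (Primrec.const 0)))

end CyclicAmalgam

namespace SeifertInvariants

open CyclicAmalgam

variable {α : Type*} [Primcodable α] {σ : α → SeifertInvariants}

theorem primrec_equivTuple (hσ : Primrec σ) : Primrec fun a => equivTuple (σ a) :=
  Primrec.of_equiv.comp hσ

theorem primrec_orientableBase (hσ : Primrec σ) : Primrec fun a => (σ a).orientableBase :=
  Primrec.fst.comp (primrec_equivTuple hσ)

theorem primrec_g (hσ : Primrec σ) : Primrec fun a => (σ a).g :=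
  Primrec.fst.comp (Primrec.snd.comp (primrec_equivTuple hσ))

theorem primrec_p (hσ : Primrec σ) : Primrec fun a => (σ a).p :=
  Primrec.fst.comp (Primrec.snd.comp (Primrec.snd.comp (primrec_equivTuple hσ)))

theorem primrec_b (hσ : Primrec σ) : Primrec fun a => (σ a).b :=
  Primrec.fst.comp (Primrec.snd.comp (Primrec.snd.comp (Primrec.snd.comp (primrec_equivTuple hσ))))

theorem primrec_exceptional (hσ : Primrec σ) : Primrec fun a => (σ a).exceptional :=
  Primrec.snd.comp (Primrec.snd.comp (Primrec.snd.comp (Primrec.snd.comp (primrec_equivTuple hσ))))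

variable {c : α → ℕ × ℕ}

theorem primrec_exceptional_get (hσ : Primrec σ) (hc : Primrec c) :
    Primrec fun a => (σ a).exceptional[(c a).2]? :=
  Primrec.list_getElem?.comp (primrec_exceptional hσ) (Primrec.snd.comp hc)

theorem primrec_codeOrd (hσ : Primrec σ) (hc : Primrec c) :
    Primrec fun a => (σ a).codeOrd (c a) :=
  Primrec.ite (Primrec.eq.comp (Primrec.fst.comp hc) (Primrec.const 2))
    (Primrec.option_getD.comp (Primrec.option_map (primrec_exceptional_get hσ hc)
      (Primrec.fst.comp Primrec.snd).to₂) (Primrec.const 0)) (Primrec.const 0)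

theorem primrec_codeTwist (hσ : Primrec σ) (hc : Primrec c) :
    Primrec fun a => (σ a).codeTwist (c a) :=
  Primrec.ite (Primrec.eq.comp (Primrec.fst.comp hc) (Primrec.const 2))
    (Primrec.int_ofNat (Primrec.option_getD.comp (Primrec.option_map
      (primrec_exceptional_get hσ hc) (Primrec.snd.comp Primrec.snd).to₂) (Primrec.const 0)))
    (Primrec.const 0)

theorem primrec_codeNeg (hσ : Primrec σ) (hc : Primrec c) :
    Primrec fun a => (σ a).codeNeg (c a) :=
  Primrec.and.comp
    (PrimrecPred.decide (Primrec.eq.comp (Primrec.fst.comp hc) (Primrec.const 0)))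
    (Primrec.and.comp (Primrec.not.comp (primrec_orientableBase hσ))
      (PrimrecPred.decide (Primrec.nat_lt.comp (Primrec.snd.comp hc) (primrec_g hσ))))

theorem primrec_act {s : α → Bool} {st : α → ℤ × List ((ℕ × ℕ) × ℕ)} (hσ : Primrec σ)
    (hc : Primrec c) (hs : Primrec s) (hst : Primrec st) :
    Primrec fun a => act (σ a).codeOrd (σ a).codeTwist (σ a).codeNeg (c a) (s a) (st a) :=
  Primrec.pair
    (Primrec.int_add
      (Primrec.ite (Primrec.eq.comp (primrec_codeNeg hσ hc) (Primrec.const true))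
        (Primrec.int_neg (Primrec.fst.comp hst)) (Primrec.fst.comp hst))
      (primrec_carry (primrec_codeOrd hσ hc) (primrec_codeTwist hσ hc) hc hs
        (Primrec.snd.comp hst)))
    (primrec_push (primrec_codeOrd hσ hc) hc hs (Primrec.snd.comp hst))

variable {w : α → List ((ℕ × ℕ) × Bool)} {st : α → ℤ × List ((ℕ × ℕ) × ℕ)} {k : α → ℕ}

theorem primrec_actWord (hσ : Primrec σ) (hw : Primrec w) (hst : Primrec st) :
    Primrec fun a => actWord (σ a).codeOrd (σ a).codeTwist (σ a).codeNeg (w a) (st a) := by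
  have h : Primrec₂ fun (a : α) (x : ((ℕ × ℕ) × Bool) × (ℤ × List ((ℕ × ℕ) × ℕ))) =>
      act (σ a).codeOrd (σ a).codeTwist (σ a).codeNeg x.1.1 x.1.2 x.2 :=
    (primrec_act (hσ.comp Primrec.fst)
      (Primrec.fst.comp (Primrec.fst.comp Primrec.snd))
      (Primrec.snd.comp (Primrec.fst.comp Primrec.snd))
      (Primrec.snd.comp Primrec.snd)).to₂
  exact Primrec.list_foldr hw hst h

theorem primrec_map_range_pair {n : α → ℕ} (hn : Primrec n) (i : ℕ) {f : α → ℕ → ℕ}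
    (hf : Primrec₂ f) : Primrec fun a => (List.range (n a)).map fun j => (i, f a j) :=
  Primrec.list_map (Primrec.list_range.comp hn) (Primrec.pair (Primrec.const i) hf)

theorem primrec_keys (hσ : Primrec σ) (hk : Primrec k) : Primrec fun a => (σ a).keys (k a) := by
  have hk1 : Primrec fun a => k a + 1 := Primrec.succ.comp hk
  refine Primrec.list_append.comp
    (primrec_map_range_pair (Primrec.nat_sub.comp (primrec_p hσ) hk1) 3
      (f := fun a j => k a + 1 + j)
      (Primrec.nat_add.comp (hk1.comp Primrec.fst) Primrec.snd).to₂)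
    (Primrec.list_append.comp (primrec_map_range_pair (primrec_g hσ) 0 Primrec.snd.to₂)
      (Primrec.list_append.comp
        (primrec_map_range_pair (Primrec.list_length.comp (primrec_exceptional hσ)) 2
          Primrec.snd.to₂)
        (primrec_map_range_pair hk 3 Primrec.snd.to₂)))

theorem primrec_singleton {β : Type*} [Primcodable β] {f : α → β} (hf : Primrec f) :
    Primrec fun a => [f a] :=
  Primrec.list_cons.comp hf (Primrec.const [])

theorem primrec_piece {o : α → Bool} (ho : Primrec o) (hc : Primrec c) :
    Primrec fun a => piece (o a) (c a) := by
  have hx : ∀ (i : ℕ) (s : Bool), Primrec fun a => ((i, (c a).2), s) := fun i s =>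
    Primrec.pair (Primrec.pair (Primrec.const i) (Primrec.snd.comp hc)) (Primrec.const s)
  exact Primrec.ite (Primrec.eq.comp (Primrec.fst.comp hc) (Primrec.const 0))
    (Primrec.ite (Primrec.eq.comp ho (Primrec.const true))
      (Primrec.list_cons.comp (hx 0 true) (Primrec.list_cons.comp (hx 1 true)
        (Primrec.list_cons.comp (hx 0 false) (primrec_singleton (hx 1 false)))))
      (Primrec.list_cons.comp (hx 0 true) (primrec_singleton (hx 0 true))))
    (primrec_singleton (Primrec.pair hc (Primrec.const true)))

theorem primrec_longWord (hσ : Primrec σ) (hk : Primrec k) :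
    Primrec fun a => (σ a).longWord (k a) :=
  Primrec.list_flatMap (primrec_keys hσ hk)
    (primrec_piece ((primrec_orientableBase hσ).comp Primrec.fst) Primrec.snd).to₂

theorem primrec_invRev (hw : Primrec w) : Primrec fun a => FreeGroup.invRev (w a) :=
  Primrec.list_reverse.comp (Primrec.list_map hw
    (Primrec.pair (Primrec.fst.comp Primrec.snd)
      (Primrec.not.comp (Primrec.snd.comp Primrec.snd))).to₂)

theorem primrec_actLetter {x : α → (ℕ × ℕ) × Bool} (hσ : Primrec σ) (hk : Primrec k)
    (hx : Primrec x) (hst : Primrec st) :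
    Primrec fun a => (σ a).actLetter (k a) (x a) (st a) := by
  have hs : PrimrecPred fun a => (x a).2 = true :=
    Primrec.eq.comp (Primrec.snd.comp hx) (Primrec.const true)
  have hL := primrec_longWord hσ hk
  have hLst := primrec_actWord hσ hL hst
  exact Primrec.ite (Primrec.eq.comp (Primrec.fst.comp hx) (Primrec.const (4, 0)))
    (Primrec.pair (Primrec.int_add (Primrec.fst.comp hst)
      (Primrec.ite hs (Primrec.const 1) (Primrec.const (-1)))) (Primrec.snd.comp hst))
    (Primrec.ite (Primrec.eq.comp (Primrec.fst.comp hx) (Primrec.pair (Primrec.const 3) hk))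
      (Primrec.ite hs
        (primrec_actWord hσ (primrec_invRev hL)
          (Primrec.pair (Primrec.int_add (Primrec.fst.comp hst) (primrec_b hσ))
            (Primrec.snd.comp hst)))
        (Primrec.pair (Primrec.int_sub (Primrec.fst.comp hLst) (primrec_b hσ))
          (Primrec.snd.comp hLst)))
      (primrec_act hσ (Primrec.fst.comp hx) (Primrec.snd.comp hx) hst))

theorem primrec_normalForm (hσ : Primrec σ) (hk : Primrec k) (hw : Primrec w) :
    Primrec fun a => (σ a).normalForm (k a) (w a) :=
  Primrec.list_foldr (h := fun a x => (σ a).actLetter (k a) x.1 x.2) hw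
    (Primrec.const (0, []))
    (primrec_actLetter (hσ.comp Primrec.fst) (hk.comp Primrec.fst)
      (Primrec.fst.comp Primrec.snd) (Primrec.snd.comp Primrec.snd)).to₂

theorem primrec_ordBound (hσ : Primrec σ) : Primrec fun a => (σ a).ordBound := by
  have h : Primrec₂ fun (_ : α) (x : (ℕ × ℕ) × ℕ) => x.1.1 + x.2 :=
    (Primrec.nat_add.comp (Primrec.fst.comp (Primrec.fst.comp Primrec.snd))
      (Primrec.snd.comp Primrec.snd)).to₂
  exact Primrec.list_foldr (primrec_exceptional hσ) (Primrec.const 1) h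

theorem primrec_searchBound {n : α → ℕ} (hσ : Primrec σ) (hk : Primrec k) (hn : Primrec n) :
    Primrec fun a => (σ a).searchBound (k a) (n a) :=
  Primrec.nat_mul.comp (Primrec.nat_mul.comp
    (Primrec.succ.comp (Primrec.list_length.comp (primrec_longWord hσ hk)))
      (Primrec.succ.comp hn)) (primrec_ordBound hσ)

theorem primrec_alphabet (hσ : Primrec σ) : Primrec fun a => (σ a).alphabet := by
  have hN : Primrec fun a => (σ a).g + (σ a).exceptional.length + (σ a).p + 1 :=
    Primrec.succ.comp (Primrec.nat_add.comp (Primrec.nat_add.comp (primrec_g hσ)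
      (Primrec.list_length.comp (primrec_exceptional hσ))) (primrec_p hσ))
  have hx : ∀ s : Bool, Primrec fun x : (α × ℕ) × ℕ => ((x.1.2, x.2), s) := fun s =>
    Primrec.pair (Primrec.pair (Primrec.snd.comp Primrec.fst) Primrec.snd) (Primrec.const s)
  exact Primrec.list_flatMap (Primrec.const (List.range 5))
    (Primrec.list_flatMap (Primrec.list_range.comp (hN.comp Primrec.fst))
      (Primrec.list_cons.comp (hx true) (primrec_singleton (hx false))).to₂).to₂

theorem primrec_wordsUpTo {n : α → ℕ} (hσ : Primrec σ) (hn : Primrec n) :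
    Primrec fun a => (σ a).wordsUpTo (n a) := by
  have h : Primrec₂ fun (a : α) (x : ℕ × List (List ((ℕ × ℕ) × Bool))) =>
      [] :: x.2.flatMap fun w => (σ a).alphabet.map fun y => y :: w :=
    (Primrec.list_cons.comp (Primrec.const [])
      (Primrec.list_flatMap (Primrec.snd.comp Primrec.snd)
        (Primrec.list_map ((primrec_alphabet hσ).comp (Primrec.fst.comp Primrec.fst))
          (Primrec.list_cons.comp Primrec.snd (Primrec.snd.comp Primrec.fst)).to₂).to₂)).to₂
  exact (Primrec.nat_rec (Primrec.const [[]]) h).comp Primrec.id hn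

theorem primrec_testWord {v : α → List ((ℕ × ℕ) × Bool)} {m : α → ℕ} (hk : Primrec k)
    (hw : Primrec w) (hv : Primrec v) (hm : Primrec m) (s : Bool) :
    Primrec fun a => testWord (k a) (w a) (v a) (m a) s :=
  Primrec.list_append.comp hv (Primrec.list_append.comp hw (Primrec.list_append.comp
    (primrec_invRev hv) (Primrec.list_map (Primrec.list_range.comp hm)
      (Primrec.pair (Primrec.pair (Primrec.const 3) (hk.comp Primrec.fst))
        (Primrec.const (!s))).to₂)))

theorem primrec_test {v : α → List ((ℕ × ℕ) × Bool)} {m : α → ℕ} (hσ : Primrec σ)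
    (hk : Primrec k) (hw : Primrec w) (hv : Primrec v) (hm : Primrec m) (s : Bool) :
    Primrec fun a => (σ a).test (k a) (w a) (v a) (m a) s := by
  have hN := primrec_normalForm hσ hk (primrec_testWord hk hw hv hm s)
  have hm' : Primrec fun a => if s = true then (m a : ℤ) else -(m a : ℤ) := by
    cases s
    · exact Primrec.int_neg (Primrec.int_ofNat hm)
    · exact Primrec.int_ofNat hm
  exact Primrec.ite (Primrec.eq.comp (Primrec.snd.comp hN) (Primrec.const []))
    (primrec_singleton (Primrec.pair hm' (Primrec.fst.comp hN))) (Primrec.const [])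

theorem primrec_search (hσ : Primrec σ) (hk : Primrec k) (hw : Primrec w) :
    Primrec fun a => (σ a).search (k a) (w a) := by
  have hB := primrec_searchBound hσ hk (Primrec.list_length.comp hw)
  have ht : ∀ s : Bool, Primrec fun x : (α × List ((ℕ × ℕ) × Bool)) × ℕ =>
      (σ x.1.1).test (k x.1.1) (w x.1.1) x.1.2 x.2 s := fun s =>
    have h1 : Primrec fun x : (α × List ((ℕ × ℕ) × Bool)) × ℕ => x.1.1 :=
      Primrec.fst.comp Primrec.fst
    primrec_test (hσ.comp h1) (hk.comp h1) (hw.comp h1) (Primrec.snd.comp Primrec.fst)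
      Primrec.snd s
  exact Primrec.list_flatMap (primrec_wordsUpTo hσ hB)
    (Primrec.list_flatMap (Primrec.list_range.comp (Primrec.succ.comp (hB.comp Primrec.fst)))
      (Primrec.list_append.comp (ht true) (ht false)).to₂).to₂

end SeifertInvariants

/-! ### Solution of the boundary parallelism problem -/

theorem proposition5p1 :
    ∃ A : SeifertInvariants × ℕ × List ((ℕ × ℕ) × Bool) × List ((ℕ × ℕ) × Bool) → List (ℤ × ℤ),
      Computable A ∧
      -- the boundary parallelism problem in the groups given by canonical presentations
      (∀ σ : SeifertInvariants, σ.IsValid →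
        ∀ (k : Fin σ.p) (u w : List (σ.Gen × Bool)),
          {t | ∃ e ∈ A (σ, (k : ℕ), SeifertInvariants.codeWord u, SeifertInvariants.codeWord w),
              t = SeifertInvariants.boundaryElement k (SeifertInvariants.wordVal u) e.1 e.2} =
            conjugatesIn (SeifertInvariants.boundarySubgroup k (SeifertInvariants.wordVal u))
              (SeifertInvariants.wordVal w)) ∧
      -- the boundary parallelism problem in the groups of Seifert fibred spaces
      (∀ (M : Type*) [TopologicalSpace M] [T2Space M] [CompactSpace M] [ConnectedSpace M]
          [ChartedSpace (EuclideanHalfSpace 3) M],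
        ((𝓡∂ 3).boundary M).Nonempty →
        ∀ (F : SeifertFibration M) (x : M) (σ : SeifertInvariants), σ.IsValid →
        ∀ (P : CanonicalPresentation F x σ) (T : Subgroup (FundamentalGroup M x)),
          IsBoundarySubgroup T →
          ∃ (k : Fin σ.p) (u : List (σ.Gen × Bool)),
            T = (SeifertInvariants.boundarySubgroup k (SeifertInvariants.wordVal u)).map
              P.toMulEquiv.toMonoidHom ∧
            ∀ w : List (σ.Gen × Bool),
              {t | ∃ e ∈ A (σ, (k : ℕ), SeifertInvariants.codeWord u, SeifertInvariants.codeWord w),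
                  t = P.toMulEquiv
                    (SeifertInvariants.boundaryElement k (SeifertInvariants.wordVal u) e.1 e.2)} =
                conjugatesIn T (P.toMulEquiv (SeifertInvariants.wordVal w))) := by
  -- The algorithm ignores the word `u`, which is the component `x.2.2.1` of its input.
  refine ⟨fun x => x.1.search x.2.1 x.2.2.2,
    (SeifertInvariants.primrec_search Primrec.fst (Primrec.fst.comp Primrec.snd)
      (Primrec.snd.comp (Primrec.snd.comp Primrec.snd))).to_comp,
    fun σ hσ k u w => SeifertInvariants.setOf_search_eq_conjugatesIn hσ k _ w, ?_⟩
  intro M _ _ _ _ _ _ F x σ hσ P T hT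
  obtain ⟨k, u, rfl⟩ := P.exists_eq_boundarySubgroup hT
  refine ⟨k, u, rfl, fun w => ?_⟩
  -- The isomorphism with the fundamental group carries conjugates to conjugates, so the second
  -- claim is the image of the first.
  rw [← image_conjugatesIn, ← SeifertInvariants.setOf_search_eq_conjugatesIn hσ]
  ext t
  constructor
  · rintro ⟨e, he, rfl⟩
    exact ⟨_, ⟨e, he, rfl⟩, rfl⟩
  · rintro ⟨_, ⟨e, he, rfl⟩, rfl⟩
    exact ⟨e, he, rfl⟩
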